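/- Let $R$ be an associative ring with identity (for instance any non-commutative algebra over a field). For an $n\times n$ matrix $A=(a_{i,j})$ over $R$ let $$\mathsf{C\text{-}perm}(A)=\sum_{\sigma\in S_n}a_{1,\sigma(1)}\cdots a_{n,\sigma(n)},\qquad \mathsf{C\text{-}det}(A)=\sum_{\sigma\in S_n}\operatorname{sgn}(\sigma)\,a_{1,\sigma(1)}\cdots a_{n,\sigma(n)},$$ the factors being multiplied in the order of the rows; for a digraph $G$ with vertices $1,\dots,n$ and edge weights in $R$, $\mathsf{C\text{-}perm}(G)$ and $\mathsf{C\text{-}det}(G)$ are those of its weighted adjacency matrix (with $0$ for non-edges). Inputs are given to a machine as adjacency matrices whose entries are binary codes of the weights; the codes are given by an arbitrary partial map $c$ from binary strings to $R$ such that a fixed string is a code of $1$. A digraph is planar if its underlying undirected graph is planar. $\mathsf{planar\text{-}C\text{-}perm}$ and $\mathsf{planar\text{-}C\text{-}det}$ are the restrictions of these problems to planar digraphs. Then $$\mathsf{C\text{-}perm}\le_m^p\mathsf{planar\text{-}C\text{-}perm}\qquad\text{and}\qquad \mathsf{C\text{-}det}\le_m^p\mathsf{planar\text{-}C\text{-}det},$$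 that is, for each of the two problems there is a map $r$, computable by a Turing machine in time polynomial in the length of the input, such that for every weighted digraph $G$ over $R$ the weighted digraph $r(G)$ over $R$ is planar and has the same Cayley permanent (respectively, Cayley determinant) as $G$. Moreover, the reductions work over any non-commutative algebra: once the string that codes $1$ is fixed, one map $r$ for each problem serves all $R$ and all codings $c$. -/

import Mathlib

/-! ### Cayley permanent and Cayley determinant -/

/-- The Cayley permanent `∑ σ, A 1 (σ 1) ⋯ A n (σ n)`; the factors are multiplied in the order of
the row indices. -/
def cayleyPerm {R : Type*} [Ring R] {n : ℕ} (A : Matrix (Fin n) (Fin n) R) : R :=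
  ∑ σ : Equiv.Perm (Fin n), (List.ofFn fun i => A i (σ i)).prod

/-- The Cayley determinant `∑ σ, sgn σ • A 1 (σ 1) ⋯ A n (σ n)`, with the same order of factors. -/
def cayleyDet {R : Type*} [Ring R] {n : ℕ} (A : Matrix (Fin n) (Fin n) R) : R :=
  ∑ σ : Equiv.Perm (Fin n), Equiv.Perm.sign σ • (List.ofFn fun i => A i (σ i)).prod

/-! ### Planar graphs -/

/-- A simple graph is planar if it can be drawn in the plane without crossings: the vertices are
distinct points, every edge is a simple arc that joins its two ends and contains no other vertex,
and two different edges meet only in vertices that are ends of both. -/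
def SimpleGraph.IsPlanar {V : Type*} (G : SimpleGraph V) : Prop :=
  ∃ (pt : V → ℝ × ℝ) (arc : Sym2 V → Set (ℝ × ℝ)),
    Function.Injective pt ∧
    (∀ u v, G.Adj u v → ∃ γ : _root_.Path (pt u) (pt v),
      Function.Injective γ ∧ Set.range γ = arc s(u, v)) ∧
    (∀ e ∈ G.edgeSet, ∀ w, pt w ∈ arc e → w ∈ e) ∧
    (∀ e ∈ G.edgeSet, ∀ f ∈ G.edgeSet, e ≠ f →
      arc e ∩ arc f ⊆ pt '' {v | v ∈ e ∧ v ∈ f})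

/-- A digraph is planar if the graph is planar that is left when loops are deleted, directions are
forgotten and antiparallel edges are merged. -/
def Digraph.IsPlanar {V : Type*} (D : Digraph V) : Prop :=
  D.toSimpleGraphInclusive.IsPlanar

/-! ### Weighted digraphs as inputs of a machine -/

/-- A finite digraph (without parallel edges) on the vertices `0, …, n - 1` whose edges carry binary
strings, the codes of the weights: `entry i j = some w` says that there is an edge from `i` to `j`
and that its weight has the code `w`, and `entry i j = none` says that there is no such edge. -/
structure CodedDigraph where
  /-- the number of vertices -/
  n : ℕ
  /-- the adjacency matrix, with the codes of the weights as entries -/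
  entry : Fin n → Fin n → Option (List Bool)

namespace CodedDigraph

open Computability

/-- The digraph without its weights. -/
def toDigraph (G : CodedDigraph) : Digraph (Fin G.n) where
  Adj i j := G.entry i j ≠ none

/-- The word that stands for an entry of the adjacency matrix. -/
def encodeEntry : Option (List Bool) → List Γ'
  | none => [Γ'.blank]
  | some w => Γ'.bra :: (w.map Γ'.bit ++ [Γ'.ket])

/-- The word that stands for a row of the adjacency matrix. -/
def encodeRow (row : List (Option (List Bool))) : List Γ' :=
  row.flatMap encodeEntry ++ [Γ'.comma]

/-- The rows of the adjacency matrix. -/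
def rows (G : CodedDigraph) : List (List (Option (List Bool))) :=
  List.ofFn fun i => List.ofFn fun j => G.entry i j

/-- The input word of a coded digraph: its adjacency matrix, row by row. -/
def encode (G : CodedDigraph) : List Γ' :=
  G.rows.flatMap encodeRow

theorem map_bit_append_inj : ∀ (v w : List Bool) (s t : List Γ'),
    v.map Γ'.bit ++ Γ'.ket :: s = w.map Γ'.bit ++ Γ'.ket :: t → v = w ∧ s = t
  | [], [], s, t, h => by simpa using h
  | [], b :: w, s, t, h => by simp at h
  | a :: v, [], s, t, h => by simp at h
  | a :: v, b :: w, s, t, h => by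
    simp only [List.map_cons, List.cons_append, List.cons.injEq, Γ'.bit.injEq] at h
    obtain ⟨rfl, h⟩ := h
    obtain ⟨rfl, rfl⟩ := map_bit_append_inj v w s t h
    exact ⟨rfl, rfl⟩

theorem encodeEntry_append_inj (a b : Option (List Bool)) (s t : List Γ')
    (h : encodeEntry a ++ s = encodeEntry b ++ t) : a = b ∧ s = t := by
  cases a with
  | none => cases b with
    | none => simpa [encodeEntry] using h
    | some w => simp [encodeEntry] at h
  | some v => cases b with
    | none => simp [encodeEntry] at h
    | some w =>
      have := map_bit_append_inj v w s t (by simpa [encodeEntry] using h)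
      exact ⟨by rw [this.1], this.2⟩

theorem encodeEntry_append_ne (a : Option (List Bool)) (s t : List Γ') :
    encodeEntry a ++ s ≠ Γ'.comma :: t := by
  cases a <;> simp [encodeEntry]

theorem encodeRow_append_inj : ∀ (l m : List (Option (List Bool))) (s t : List Γ'),
    encodeRow l ++ s = encodeRow m ++ t → l = m ∧ s = t
  | [], [], s, t, h => by simpa [encodeRow] using h
  | [], b :: m, s, t, h => by
    simp only [encodeRow, List.flatMap_nil, List.flatMap_cons, List.append_assoc, List.nil_append,
      List.cons_append] at h
    exact absurd h.symm (encodeEntry_append_ne _ _ _)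
  | a :: l, [], s, t, h => by
    simp only [encodeRow, List.flatMap_nil, List.flatMap_cons, List.append_assoc, List.nil_append,
      List.cons_append] at h
    exact absurd h (encodeEntry_append_ne _ _ _)
  | a :: l, b :: m, s, t, h => by
    simp only [encodeRow, List.flatMap_cons, List.append_assoc] at h
    obtain ⟨rfl, h⟩ := encodeEntry_append_inj _ _ _ _ h
    obtain ⟨rfl, rfl⟩ := encodeRow_append_inj l m s t (by simpa [encodeRow] using h)
    exact ⟨rfl, rfl⟩

theorem flatMap_encodeRow_inj : ∀ (l m : List (List (Option (List Bool)))),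
    l.flatMap encodeRow = m.flatMap encodeRow → l = m
  | [], [], _ => rfl
  | [], b :: m, h => by simp [encodeRow] at h
  | a :: l, [], h => by simp [encodeRow] at h
  | a :: l, b :: m, h => by
    simp only [List.flatMap_cons] at h
    obtain ⟨h₁, h₂⟩ := encodeRow_append_inj _ _ _ _ h
    rw [h₁, flatMap_encodeRow_inj l m h₂]

/-- Different coded digraphs have different input words. -/
theorem encode_injective : Function.Injective encode := by
  rintro ⟨n, A⟩ ⟨m, B⟩ h
  have h := flatMap_encodeRow_inj _ _ h
  have hn : n = m := by simpa [rows] using congrArg List.length h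
  subst hn
  have h := List.ofFn_injective h
  congr
  funext i
  exact List.ofFn_injective (congrFun h i)

variable {R : Type*} [Ring R]

/-- All the weights of `G` are codes of elements of `R`. Here `c` says which element of `R`, if any,
a binary string stands for. -/
def HasWeightsIn (c : List Bool → Option R) (G : CodedDigraph) : Prop :=
  ∀ i j w, G.entry i j = some w → c w ≠ none

/-- The weighted adjacency matrix over `R`: the weight of the edge from `i` to `j` if there is one,
and `0` otherwise. -/
def weightMatrix (c : List Bool → Option R) (G : CodedDigraph) : Matrix (Fin G.n) (Fin G.n) R :=
  fun i j => ((G.entry i j).bind c).getD 0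

end CodedDigraph

/-! ### The computational problems and the reductions -/

/-- The problem of the Cayley permanent over `R`: from a weighted digraph, compute the Cayley
permanent of its weighted adjacency matrix. The domain of the partial function is the set of
admissible inputs. -/
def CPerm {R : Type*} [Ring R] (c : List Bool → Option R) : CodedDigraph →. R := fun G =>
  ⟨G.HasWeightsIn c, fun _ => cayleyPerm (G.weightMatrix c)⟩

/-- The restriction of the problem of the Cayley permanent to planar digraphs. -/
def planarCPerm {R : Type*} [Ring R] (c : List Bool → Option R) : CodedDigraph →. R := fun G =>
  ⟨G.HasWeightsIn c ∧ G.toDigraph.IsPlanar, fun _ => cayleyPerm (G.weightMatrix c)⟩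

/-- The problem of the Cayley determinant over `R`. -/
def CDet {R : Type*} [Ring R] (c : List Bool → Option R) : CodedDigraph →. R := fun G =>
  ⟨G.HasWeightsIn c, fun _ => cayleyDet (G.weightMatrix c)⟩

/-- The restriction of the problem of the Cayley determinant to planar digraphs. -/
def planarCDet {R : Type*} [Ring R] (c : List Bool → Option R) : CodedDigraph →. R := fun G =>
  ⟨G.HasWeightsIn c ∧ G.toDigraph.IsPlanar, fun _ => cayleyDet (G.weightMatrix c)⟩

/-- `r` is a many-one reduction from `P` to `Q`: it maps every admissible input of `P` to an
admissible input of `Q` with the same value. -/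
def IsManyOneReduction {α β ρ : Type*} (r : α → β) (P : α →. ρ) (Q : β →. ρ) : Prop :=
  ∀ x, ∀ v ∈ P x, v ∈ Q (r x)

/-- `r` is computed by a Turing machine in a number of steps that is bounded by a polynomial in the
length of the input word. -/
def IsPolyTime (r : CodedDigraph → CodedDigraph) : Prop :=
  Nonempty (Turing.TM2ComputableInPolyTime CodedDigraph.encode CodedDigraph.encode r)

/-!
The reduction sends a digraph `G` on `n` vertices to a planar digraph, the *crossbar*. For each pair
`(i, j)` it has a switch, whose loop stands for the edge from `i` to `j` of `G` and carries its
weight, and a wire; the wires of the last row are idle and have nothing but a loop. All other edges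
are the same for all `G` with `n` vertices, and all weights but those of the switches are `1`.

A cover of the crossbar by cycles is a permutation of its vertices along edges. From the switches of
a column the only ways out, apart from the loops, are the `n - 1` wires of the column that are not
idle, and the wire `i` is reached from the switches `i` and `i + 1`; so exactly one switch of every
column keeps its loop, and this choice determines how the other switches are matched with the wires.
Dually, the wires that are not idle are distributed over the rows in such a way that in each row
there is exactly one wire for each of the `n - 1` pairs of neighbouring switches; so exactly one
switch of every row keeps its loop. Hence the covers correspond to the permutations `σ` of the
vertices of `G`: the loops that are used are those of the switches `(i, σ i)`
(`CrossbarCompatible.exists_eq_crossbarPerm`, `crossbarPerm_selected_iff`). As the vertices are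
numbered by rows, the weights of these loops are multiplied in the order of the rows, and all other
factors are `1`, so no commutativity is needed. The sign of the cover is that of `σ`: up to
permutations whose signs cancel, it is the product of `σ⁻¹`, acting on one column, and of
`n * (n - 1)` transpositions that exchange a switch and a wire, an even number
(`sign_crossbarPerm`). Therefore one and the same map serves for the permanent and
for the determinant.

The crossbar embeds into the square lattice: the switches of the row `i` are put on an
antidiagonal of the lattice, and the wire `(i, j)` half way between the switches `(i, j)` and
`(i + 1, j)` (`crossbarPlace`, `CrossbarEdge.latticeAdj`). Drawn with unit segments, it is planar
(`SimpleGraph.isPlanar_of_lattice`).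

For the running time the reduction is carried out by a machine with several stacks. Machines are
obtained from structured programs, built from single steps by composition and loops
(`StackProgram.computableInPolyTime`). The program keeps, instead of numbers of vertices, lists of
marks of a bounded size: the marks of a place `c` tell whether its row and column are the first, the
second or the last ones, and whether it lies above the diagonal. The ends of the edges from a
place are found by walking through the marks of the places `q - c`, counted cyclically, in the order
of the places `q`; since all places are numbered consecutively, passing to the next `c` is
a rotation of this list by one place (`relativeMarks_rotate`), and every edge of the crossbar is
determined by the mark of `c` and that of `q - c` (`switchToWire_iff`, `wireToSwitch_iff`,
`wireToWire_iff`).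
-/

/-! ### Subgraphs of the square lattice are planar -/

/-- The point of the plane with the given integer coordinates. -/
def latticePoint (z : ℤ × ℤ) : ℝ × ℝ := (z.1, z.2)

/-- `z` and `w` are neighbours in the square lattice. -/
def LatticeAdj (z w : ℤ × ℤ) : Prop :=
  (z.1 = w.1 ∧ (z.2 + 1 = w.2 ∨ w.2 + 1 = z.2)) ∨ (z.2 = w.2 ∧ (z.1 + 1 = w.1 ∨ w.1 + 1 = z.1))

theorem mem_uIcc_latticePoint {z w : ℤ × ℤ} {p : ℝ × ℝ} :
    p ∈ Set.uIcc (latticePoint z) (latticePoint w) ↔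
      (((min z.1 w.1 : ℤ) : ℝ) ≤ p.1 ∧ p.1 ≤ ((max z.1 w.1 : ℤ) : ℝ)) ∧
      (((min z.2 w.2 : ℤ) : ℝ) ≤ p.2 ∧ p.2 ≤ ((max z.2 w.2 : ℤ) : ℝ)) := by
  rw [Set.uIcc, Set.mem_Icc, Prod.le_def, Prod.le_def]
  simp only [latticePoint, Prod.fst_inf, Prod.snd_inf, Prod.fst_sup, Prod.snd_sup, Int.cast_min,
    Int.cast_max]
  tauto

/-- A lattice edge, as a degenerate box, is the simple arc that runs straight along it. -/
theorem exists_path_range_eq_uIcc {z w : ℤ × ℤ} (h : LatticeAdj z w) :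
    ∃ γ : _root_.Path (latticePoint z) (latticePoint w),
      Function.Injective γ ∧ Set.range γ = Set.uIcc (latticePoint z) (latticePoint w) := by
  have hne : latticePoint z ≠ latticePoint w := by
    intro e
    simp only [latticePoint, Prod.mk.injEq, Int.cast_inj] at e
    rcases h with h | h <;> omega
  let γ : _root_.Path (latticePoint z) (latticePoint w) :=
    { toFun := fun t => AffineMap.lineMap (latticePoint z) (latticePoint w) (t : ℝ)
      continuous_toFun := by
        have := AffineMap.lineMap_continuous (R := ℝ) (p := latticePoint z) (q := latticePoint w)
        exact this.comp continuous_subtype_val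
      source' := by simp
      target' := by simp }
  refine ⟨γ, ?_, ?_⟩
  · intro s t hst
    exact Subtype.ext (AffineMap.lineMap_injective ℝ hne hst)
  · have hr : Set.range γ = segment ℝ (latticePoint z) (latticePoint w) := by
      rw [segment_eq_image_lineMap]
      ext p
      constructor
      · rintro ⟨t, rfl⟩
        exact ⟨t, t.2, rfl⟩
      · rintro ⟨t, ht, rfl⟩
        exact ⟨⟨t, ht⟩, rfl⟩
    rw [hr]
    rcases h with ⟨h, -⟩ | ⟨h, -⟩
    · have : latticePoint w = ((z.1 : ℝ), (w.2 : ℝ)) := by simp [latticePoint, h]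
      rw [this, latticePoint, ← Prod.image_mk_segment_right, segment_eq_uIcc]
      ext ⟨a, b⟩
      simp only [Set.uIcc, Set.mem_image, Set.mem_Icc, Prod.mk.injEq, Prod.mk_le_mk, Prod.mk_inf_mk,
        Prod.mk_sup_mk, inf_idem, sup_idem]
      constructor
      · rintro ⟨x, hx, rfl, rfl⟩
        exact ⟨⟨le_rfl, hx.1⟩, le_rfl, hx.2⟩
      · rintro ⟨⟨h₁, h₂⟩, h₃, h₄⟩
        exact ⟨b, ⟨h₂, h₄⟩, le_antisymm h₁ h₃, rfl⟩
    · have : latticePoint w = ((w.1 : ℝ), (z.2 : ℝ)) := by simp [latticePoint, h]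
      rw [this, latticePoint, ← Prod.image_mk_segment_left, segment_eq_uIcc]
      ext ⟨a, b⟩
      simp only [Set.uIcc, Set.mem_image, Set.mem_Icc, Prod.mk.injEq, Prod.mk_le_mk, Prod.mk_inf_mk,
        Prod.mk_sup_mk, inf_idem, sup_idem]
      constructor
      · rintro ⟨x, hx, rfl, rfl⟩
        exact ⟨⟨hx.1, le_rfl⟩, hx.2, le_rfl⟩
      · rintro ⟨⟨h₁, h₂⟩, h₃, h₄⟩
        exact ⟨a, ⟨h₁, h₃⟩, rfl, le_antisymm h₂ h₄⟩

theorem eq_of_latticePoint_mem {z w u : ℤ × ℤ} (h : LatticeAdj z w)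
    (hu : latticePoint u ∈ Set.uIcc (latticePoint z) (latticePoint w)) : u = z ∨ u = w := by
  rw [mem_uIcc_latticePoint] at hu
  simp only [latticePoint, Int.cast_le] at hu
  rw [Prod.ext_iff, Prod.ext_iff]
  rcases h with h | h <;> omega

/-- The two kinds of lattice edges, up to the order of the ends, with the points on them. -/
theorem LatticeAdj.exists_eq {a b : ℤ × ℤ} (h : LatticeAdj a b) : ∃ x y : ℤ,
    (((a = (x, y) ∧ b = (x + 1, y)) ∨ (b = (x, y) ∧ a = (x + 1, y))) ∧
      ∀ p ∈ Set.uIcc (latticePoint a) (latticePoint b),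
        ((x : ℝ) ≤ p.1 ∧ p.1 ≤ x + 1) ∧ p.2 = y) ∨
    (((a = (x, y) ∧ b = (x, y + 1)) ∨ (b = (x, y) ∧ a = (x, y + 1))) ∧
      ∀ p ∈ Set.uIcc (latticePoint a) (latticePoint b),
        p.1 = x ∧ (y : ℝ) ≤ p.2 ∧ p.2 ≤ y + 1) := by
  obtain ⟨a₁, a₂⟩ := a
  obtain ⟨b₁, b₂⟩ := b
  refine ⟨min a₁ b₁, min a₂ b₂, ?_⟩
  simp only [mem_uIcc_latticePoint]
  rcases h with ⟨h, k | k⟩ | ⟨h, k | k⟩ <;> dsimp only at h k <;> subst h k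
  · exact Or.inr ⟨Or.inl (by simp), by simp +contextual [le_antisymm_iff]⟩
  · exact Or.inr ⟨Or.inr (by simp), by simp +contextual [le_antisymm_iff]⟩
  · exact Or.inl ⟨Or.inl (by simp), by simp +contextual [le_antisymm_iff]⟩
  · exact Or.inl ⟨Or.inr (by simp), by simp +contextual [le_antisymm_iff]⟩

/-- Two lattice edges with a common point have a common end there or are equal. -/
theorem lattice_edges_inter {a b c d : ℤ × ℤ} (h : LatticeAdj a b) (h' : LatticeAdj c d)
    {p : ℝ × ℝ} (hp : p ∈ Set.uIcc (latticePoint a) (latticePoint b))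
    (hp' : p ∈ Set.uIcc (latticePoint c) (latticePoint d)) :
    ((a = c ∧ b = d) ∨ (a = d ∧ b = c)) ∨
      ∃ u, p = latticePoint u ∧ (u = a ∨ u = b) ∧ (u = c ∨ u = d) := by
  -- parallel edges on one line: their positions differ by at most `1`
  have line : ∀ {x x' : ℤ} {s : ℝ}, (x : ℝ) ≤ s ∧ s ≤ x + 1 → (x' : ℝ) ≤ s ∧ s ≤ x' + 1 →
      x = x' ∨ (x' = x + 1 ∧ s = (x + 1 : ℤ)) ∨ (x = x' + 1 ∧ s = (x' + 1 : ℤ)) := by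
    intro x x' s h₁ h₂
    have k₁ : x ≤ x' + 1 := by exact_mod_cast h₁.1.trans h₂.2
    have k₂ : x' ≤ x + 1 := by exact_mod_cast h₂.1.trans h₁.2
    rcases (by omega : x = x' ∨ x' = x + 1 ∨ x = x' + 1) with rfl | rfl | rfl
    · exact Or.inl rfl
    · exact Or.inr (Or.inl ⟨rfl, le_antisymm (by exact_mod_cast h₁.2) h₂.1⟩)
    · exact Or.inr (Or.inr ⟨rfl, le_antisymm (by exact_mod_cast h₂.2) h₁.1⟩)
  -- perpendicular edges: the coordinate of the one is an end of the other
  have cross : ∀ {x x' : ℤ} {s : ℝ}, (x : ℝ) ≤ s ∧ s ≤ x + 1 → s = x' → x' = x ∨ x' = x + 1 := by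
    rintro x x' s h₁ rfl
    have k₁ : x ≤ x' := by exact_mod_cast h₁.1
    have k₂ : x' ≤ x + 1 := by exact_mod_cast h₁.2
    omega
  obtain ⟨s, t⟩ := p
  obtain ⟨x, y, ⟨ha, hb⟩ | ⟨ha, hb⟩⟩ := h.exists_eq <;>
  obtain ⟨x', y', ⟨hc, hd⟩ | ⟨hc, hd⟩⟩ := h'.exists_eq <;>
  replace hb := hb _ hp <;> replace hd := hd _ hp' <;> dsimp only at hb hd
  · obtain rfl : y = y' := by exact_mod_cast hb.2.symm.trans hd.2
    rcases line hb.1 hd.1 with rfl | ⟨rfl, e⟩ | ⟨rfl, e⟩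
    · left
      rcases ha with ⟨rfl, rfl⟩ | ⟨rfl, rfl⟩ <;> rcases hc with ⟨rfl, rfl⟩ | ⟨rfl, rfl⟩ <;> simp
    · refine Or.inr ⟨(x + 1, y), Prod.ext e hb.2, ?_, ?_⟩
      · rcases ha with ⟨rfl, rfl⟩ | ⟨rfl, rfl⟩ <;> simp
      · rcases hc with ⟨rfl, rfl⟩ | ⟨rfl, rfl⟩ <;> simp
    · refine Or.inr ⟨(x' + 1, y), Prod.ext e hb.2, ?_, ?_⟩
      · rcases ha with ⟨rfl, rfl⟩ | ⟨rfl, rfl⟩ <;> simp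
      · rcases hc with ⟨rfl, rfl⟩ | ⟨rfl, rfl⟩ <;> simp
  · refine Or.inr ⟨(x', y), Prod.ext hd.1 hb.2, ?_, ?_⟩
    · rcases ha with ⟨rfl, rfl⟩ | ⟨rfl, rfl⟩ <;> simpa [or_comm] using cross hb.1 hd.1
    · rcases hc with ⟨rfl, rfl⟩ | ⟨rfl, rfl⟩ <;> simpa [or_comm] using cross hd.2 hb.2
  · refine Or.inr ⟨(x, y'), Prod.ext hb.1 hd.2, ?_, ?_⟩
    · rcases ha with ⟨rfl, rfl⟩ | ⟨rfl, rfl⟩ <;> simpa [or_comm] using cross hb.2 hd.2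
    · rcases hc with ⟨rfl, rfl⟩ | ⟨rfl, rfl⟩ <;> simpa [or_comm] using cross hd.1 hb.1
  · obtain rfl : x = x' := by exact_mod_cast hb.1.symm.trans hd.1
    rcases line hb.2 hd.2 with rfl | ⟨rfl, e⟩ | ⟨rfl, e⟩
    · left
      rcases ha with ⟨rfl, rfl⟩ | ⟨rfl, rfl⟩ <;> rcases hc with ⟨rfl, rfl⟩ | ⟨rfl, rfl⟩ <;> simp
    · refine Or.inr ⟨(x, y + 1), Prod.ext hb.1 e, ?_, ?_⟩
      · rcases ha with ⟨rfl, rfl⟩ | ⟨rfl, rfl⟩ <;> simp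
      · rcases hc with ⟨rfl, rfl⟩ | ⟨rfl, rfl⟩ <;> simp
    · refine Or.inr ⟨(x, y' + 1), Prod.ext hb.1 e, ?_, ?_⟩
      · rcases ha with ⟨rfl, rfl⟩ | ⟨rfl, rfl⟩ <;> simp
      · rcases hc with ⟨rfl, rfl⟩ | ⟨rfl, rfl⟩ <;> simp

/-- A graph that embeds into the square lattice is planar: draw it there, with unit segments as
edges. -/
theorem SimpleGraph.isPlanar_of_lattice {V : Type*} (G : SimpleGraph V) (f : V → ℤ × ℤ)
    (hf : Function.Injective f) (h : ∀ u v, G.Adj u v → LatticeAdj (f u) (f v)) : G.IsPlanar := by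
  have hpt : Function.Injective fun v => latticePoint (f v) := by
    intro u v huv
    apply hf
    simpa [latticePoint, Prod.ext_iff] using huv
  refine ⟨fun v => latticePoint (f v), Sym2.lift ⟨fun u v =>
    Set.uIcc (latticePoint (f u)) (latticePoint (f v)), fun _ _ => Set.uIcc_comm _ _⟩,
    hpt, ?_, ?_, ?_⟩
  · intro u v huv
    exact exists_path_range_eq_uIcc (h u v huv)
  · intro e he w hw
    induction e with | _ u v
    rcases eq_of_latticePoint_mem (h u v he) hw with h | h
    · simp [hf h]
    · simp [hf h]
  · intro e he e' he' hne p hp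
    induction e with | _ u v
    induction e' with | _ u' v'
    rcases lattice_edges_inter (h u v he) (h u' v' he') hp.1 hp.2 with h | ⟨x, rfl, h₁, h₂⟩
    · exfalso
      apply hne
      rw [Sym2.eq_iff]
      rcases h with ⟨h₁, h₂⟩ | ⟨h₁, h₂⟩
      · exact Or.inl ⟨hf h₁, hf h₂⟩
      · exact Or.inr ⟨hf h₁, hf h₂⟩
    · rcases h₁ with rfl | rfl
      · exact ⟨u, ⟨by simp, by simpa [hf.eq_iff] using h₂⟩, rfl⟩
      · exact ⟨v, ⟨by simp, by simpa [hf.eq_iff] using h₂⟩, rfl⟩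

/-! ### The crossbar digraph -/

/-- The vertices of the crossbar of size `n`: for every pair `(i, j)` the *switch* `((i, j), 0)` and
the *wire* `((i, j), 1)`. The wire lies between the switches in the places `(i, j)` and
`(i + 1, j)`; the wires of the last row are idle. -/
abbrev CrossbarVertex (n : ℕ) : Type := (Fin n × Fin n) × Fin 2

/-- The edges of weight `1` of the crossbar. A switch leads to the wires below and above it
that are not idle. An idle wire has a loop. Any other wire leads to two neighbouring switches of one
row: if its place is on or below the diagonal, to the switch below it and the next one in that row, and if its place is above
the diagonal, to the switch above it and the previous one in that row. -/
def CrossbarEdge {n : ℕ} (p q : CrossbarVertex n) : Prop :=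
  (p.2 = 0 ∧ q.2 = 1 ∧ p.1.2 = q.1.2 ∧
    ((p.1.1 = q.1.1 ∧ p.1.1.val + 1 < n) ∨ q.1.1.val + 1 = p.1.1.val)) ∨
  (p.2 = 1 ∧ q = p ∧ p.1.1.val + 1 = n) ∨
  (p.2 = 1 ∧ q.2 = 0 ∧ p.1.2 ≤ p.1.1 ∧ q.1.1.val = p.1.1.val + 1 ∧
    (q.1.2 = p.1.2 ∨ q.1.2.val = p.1.2.val + 1)) ∨
  (p.2 = 1 ∧ q.2 = 0 ∧ p.1.1 < p.1.2 ∧ p.1.1.val + 1 < n ∧ q.1.1 = p.1.1 ∧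
    (q.1.2 = p.1.2 ∨ q.1.2.val + 1 = p.1.2.val))

instance {n : ℕ} : DecidableRel (CrossbarEdge (n := n)) := fun _ _ => by
  unfold CrossbarEdge; infer_instance

/-- The place of a vertex of the crossbar in the square lattice. -/
def crossbarPlace {n : ℕ} (p : CrossbarVertex n) : ℤ × ℤ :=
  (p.1.2, 2 * p.1.1 + p.2 - p.1.2)

theorem crossbarPlace_injective (n : ℕ) : Function.Injective (crossbarPlace (n := n)) := by
  rintro ⟨⟨i, j⟩, t⟩ ⟨⟨i', j'⟩, t'⟩ h
  simp only [crossbarPlace, Prod.mk.injEq, Fin.ext_iff] at h ⊢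
  omega

theorem CrossbarEdge.latticeAdj {n : ℕ} {p q : CrossbarVertex n} (h : CrossbarEdge p q)
    (hne : p ≠ q) : LatticeAdj (crossbarPlace p) (crossbarPlace q) := by
  obtain ⟨⟨i, j⟩, t⟩ := p
  obtain ⟨⟨i', j'⟩, t'⟩ := q
  simp only [CrossbarEdge, crossbarPlace, LatticeAdj, Prod.mk.injEq, Fin.ext_iff, Fin.le_def,
    Fin.lt_def, ne_eq, Fin.val_zero, Fin.val_one] at h hne ⊢
  omega

theorem LatticeAdj.symm {z w : ℤ × ℤ} (h : LatticeAdj z w) : LatticeAdj w z := by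
  simp only [LatticeAdj] at *
  omega

/-- The numbering of the vertices of the crossbar: by places, row by row, with the switch before the
wire. -/
def crossbarIndex (n : ℕ) : CrossbarVertex n ≃ Fin (n * n * 2) :=
  (finProdFinEquiv.prodCongr (Equiv.refl _)).trans finProdFinEquiv

namespace CodedDigraph

/-- The crossbar of a coded digraph `G`: the switch in the place `(i, j)` has a loop with the weight
of the edge from `i` to `j` of `G`, and all other edges have the weight coded by `one`. -/
def crossbar (one : List Bool) (G : CodedDigraph) : CodedDigraph where
  n := G.n * G.n * 2
  entry x y :=
    let p := (crossbarIndex G.n).symm x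
    let q := (crossbarIndex G.n).symm y
    if p.2 = 0 ∧ q = p then G.entry p.1.1 p.1.2 else if CrossbarEdge p q then some one else none

theorem crossbar_entry (one : List Bool) (G : CodedDigraph) (p q : CrossbarVertex G.n) :
    (G.crossbar one).entry (crossbarIndex G.n p) (crossbarIndex G.n q) =
      if p.2 = 0 ∧ q = p then G.entry p.1.1 p.1.2
      else if CrossbarEdge p q then some one else none := by
  simp [crossbar]

theorem crossbar_isPlanar (one : List Bool) (G : CodedDigraph) :
    (G.crossbar one).toDigraph.IsPlanar := by
  have key : ∀ x y, x ≠ y → (G.crossbar one).entry x y ≠ none →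
      LatticeAdj (crossbarPlace ((crossbarIndex G.n).symm x))
        (crossbarPlace ((crossbarIndex G.n).symm y)) := by
    intro x y hne h
    obtain ⟨p, rfl⟩ := (crossbarIndex G.n).surjective x
    obtain ⟨q, rfl⟩ := (crossbarIndex G.n).surjective y
    rw [crossbar_entry] at h
    have hpq : p ≠ q := fun e => hne (congrArg _ e)
    rw [if_neg (fun e => hpq e.2.symm)] at h
    have hE : CrossbarEdge p q := by
      by_contra hc
      exact h (if_neg hc)
    simpa using hE.latticeAdj hpq
  refine SimpleGraph.isPlanar_of_lattice _ (fun x => crossbarPlace ((crossbarIndex G.n).symm x))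
    ((crossbarPlace_injective _).comp (Equiv.injective _)) fun x y hxy => ?_
  obtain ⟨hne, h | h⟩ := hxy
  · exact key x y hne h
  · exact (key y x (Ne.symm hne) h).symm

end CodedDigraph

section

open Equiv

/-! ### Permutations that are compatible with the crossbar -/


/-- The permutation of `Fin (k + 1)` that maps the last element to `a` and is increasing on the
others. -/
def insertLast {k : ℕ} (a : Fin (k + 1)) : Perm (Fin (k + 1)) :=
  (finSuccEquiv' (Fin.last k)).trans (finSuccEquiv' a).symm

@[simp] theorem insertLast_last {k : ℕ} (a : Fin (k + 1)) : insertLast a (Fin.last k) = a := by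
  simp [insertLast]

@[simp] theorem insertLast_castSucc {k : ℕ} (a : Fin (k + 1)) (j : Fin k) :
    insertLast a j.castSucc = a.succAbove j := by
  rw [← Fin.succAbove_last_apply]
  simp only [insertLast, trans_apply, finSuccEquiv'_succAbove, finSuccEquiv'_symm_some]

@[simp] theorem insertLast_symm_self {k : ℕ} (a : Fin (k + 1)) :
    (insertLast a).symm a = Fin.last k := by
  rw [Equiv.symm_apply_eq]; simp

@[simp] theorem insertLast_symm_succAbove {k : ℕ} (a : Fin (k + 1)) (j : Fin k) :
    (insertLast a).symm (a.succAbove j) = j.castSucc := by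
  rw [Equiv.symm_apply_eq]; simp

theorem succAbove_eq_or {k : ℕ} (a : Fin (k + 1)) (j : Fin k) :
    a.succAbove j = j.castSucc ∨ a.succAbove j = j.succ := by
  rw [Fin.succAbove]
  split_ifs <;> simp

/-- An injective map that moves every element by at most one place skips exactly one element. -/
theorem exists_eq_succAbove {k : ℕ} (f : Fin k → Fin (k + 1)) (hf : Function.Injective f)
    (h : ∀ j, f j = j.castSucc ∨ f j = j.succ) : ∃ a : Fin (k + 1), f = a.succAbove := by
  have hmono : StrictMono f := by
    intro i j hij
    have hne : f i ≠ f j := fun e => hij.ne (hf e)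
    have hi := h i
    have hj := h j
    simp only [ne_eq, Fin.ext_iff, Fin.lt_def, Fin.val_castSucc, Fin.val_succ] at *
    omega
  obtain ⟨a, ha⟩ : ∃ a, a ∉ Set.range f := by
    by_contra! hc
    have := Fintype.card_le_of_surjective f hc
    simp at this
  refine ⟨a, (StrictMono.range_inj hmono (Fin.strictMono_succAbove a)).1 ?_⟩
  rw [Fin.range_succAbove]
  have hsub : Finset.univ.image f ⊆ {a}ᶜ := by
    intro x hx
    obtain ⟨i, -, rfl⟩ := Finset.mem_image.1 hx
    simp only [Finset.mem_compl, Finset.mem_singleton]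
    exact fun e => ha ⟨i, e⟩
  have := Finset.eq_of_subset_of_card_le hsub (by
    rw [Finset.card_image_of_injective _ hf, Finset.card_compl]; simp)
  simpa using congrArg (fun s : Finset (Fin (k + 1)) => (s : Set (Fin (k + 1)))) this

section

variable {k : ℕ}

/-- The wires that are not idle, numbered by the pairs of neighbouring switches of one row that
they lead to: the wire `(i, j)` leads to the switches `(r, s)` and `(r, s + 1)` if
`wireTarget (i, j) = (r, s)`. On the last row the values are chosen so that `wireTarget` is a
permutation. -/
def wireTarget (k : ℕ) : Perm (Fin (k + 1) × Fin (k + 1)) :=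
  (prodCongrLeft fun j => insertLast j).trans (prodCongrRight fun i => (insertLast i).symm)

/-- The permutation of the vertices of the crossbar that belongs to the permutation `σ`: exactly the
switches in the places `(i, σ i)` are fixed, and any other switch leads to its
neighbouring wire on the side of the fixed switch of its column.

It is a product of five permutations, the last one being applied first. This one moves the fixed
switch of every column to the last row and keeps the order of the others; then switches and wires
are exchanged, except in the last row; the wires, now in the places of switches, go to their
targets, and the fixed switch of the column `j` to the place `(j, k)`; in the last column it is
moved to its row; finally, in every row it is moved from the last place to its column, with the others in
order. -/
def crossbarPerm (σ : Perm (Fin (k + 1))) : Perm (CrossbarVertex (k + 1)) :=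
  let onSwitches (π : Perm (Fin (k + 1) × Fin (k + 1))) : Perm (CrossbarVertex (k + 1)) :=
    prodCongrLeft fun t => if t = 0 then π else 1
  onSwitches (prodCongrRight fun i => insertLast (σ i)) *
  onSwitches (prodCongrLeft fun j => if j = Fin.last k then σ⁻¹ else 1) *
  onSwitches (wireTarget k) *
  (prodCongrRight fun c => if c.1 = Fin.last k then 1 else swap 0 1) *
  (onSwitches (prodCongrLeft fun j => insertLast (σ⁻¹ j)))⁻¹

theorem sign_crossbarPerm (σ : Perm (Fin (k + 1))) : Perm.sign (crossbarPerm σ) = Perm.sign σ := by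
  have h₁ : ∏ i, Perm.sign (insertLast (σ i)) = ∏ i, Perm.sign (insertLast (k := k) i) :=
    Equiv.prod_comp σ fun i => Perm.sign (insertLast i)
  have h₂ : ∏ i, Perm.sign (insertLast (σ⁻¹ i)) = ∏ i, Perm.sign (insertLast (k := k) i) :=
    Equiv.prod_comp σ⁻¹ fun i => Perm.sign (insertLast i)
  -- there are `k * (k + 1)` transpositions, an even number
  have h₃ : ∏ c : Fin (k + 1) × Fin (k + 1),
      Perm.sign (if c.1 = Fin.last k then 1 else swap (0 : Fin 2) 1) = 1 := by
    rw [Fintype.prod_prod_type, Fin.prod_univ_castSucc]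
    simp only [Fin.castSucc_ne_last, if_true, if_false,
      map_one, one_pow, mul_one, Finset.prod_const, Finset.card_univ, Fintype.card_fin]
    rw [Perm.sign_swap (by decide), ← pow_mul, mul_comm]
    exact (Nat.even_mul_succ_self k).neg_one_pow
  have h₄ : Perm.sign (wireTarget k) = 1 := by
    simp only [wireTarget, Perm.sign_trans, Perm.sign_prodCongrLeft, Perm.sign_prodCongrRight,
      Perm.sign_symm]
    exact Int.units_mul_self _
  have h₅ : ∏ j, Perm.sign (if j = Fin.last k then σ⁻¹ else 1) = Perm.sign σ := by
    rw [Finset.prod_eq_single (Fin.last k)] <;> simp +contextual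
  simp only [crossbarPerm, map_mul, map_inv, Perm.sign_prodCongrLeft,
    Perm.sign_prodCongrRight, Fin.prod_univ_two, h₃, if_true, one_ne_zero, if_false, map_one,
    mul_one, h₁, h₂, h₄, h₅]
  rw [mul_right_comm, mul_inv_cancel, one_mul]

theorem wireTarget_castSucc (i : Fin k) (j : Fin (k + 1)) (s : Fin k)
    (h : (j.succAbove i).succAbove s = j) :
    wireTarget k (i.castSucc, j) = (j.succAbove i, s.castSucc) := by
  simp only [wireTarget, trans_apply, prodCongrLeft_apply, prodCongrRight_apply,
    insertLast_castSucc, Prod.mk.injEq, true_and]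
  rw [Equiv.symm_apply_eq, insertLast_castSucc, h]

theorem wireTarget_last (j : Fin (k + 1)) : wireTarget k (Fin.last k, j) = (j, Fin.last k) := by
  simp [wireTarget]

theorem crossbarPerm_idle (σ : Perm (Fin (k + 1))) (j : Fin (k + 1)) :
    crossbarPerm σ ((Fin.last k, j), 1) = ((Fin.last k, j), 1) := by
  simp only [crossbarPerm, Perm.mul_apply]
  rw [(Perm.inv_eq_iff_eq (y := ((Fin.last k, j), (1 : Fin 2)))).2] <;> simp

theorem crossbarPerm_wire (σ : Perm (Fin (k + 1))) (i : Fin k) (j r : Fin (k + 1)) (s : Fin k)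
    (h : wireTarget k (i.castSucc, j) = (r, s.castSucc)) :
    crossbarPerm σ ((i.castSucc, j), 1) = ((r, (σ r).succAbove s), 0) := by
  simp only [crossbarPerm, Perm.mul_apply]
  rw [(Perm.inv_eq_iff_eq (y := ((i.castSucc, j), (1 : Fin 2)))).2 (by simp)]
  simp [h, Fin.castSucc_ne_last]

theorem crossbarPerm_selected (σ : Perm (Fin (k + 1))) (i : Fin (k + 1)) :
    crossbarPerm σ ((i, σ i), 0) = ((i, σ i), 0) := by
  simp only [crossbarPerm, Perm.mul_apply]
  rw [(Perm.inv_eq_iff_eq (y := ((Fin.last k, σ i), (0 : Fin 2)))).2 (by simp)]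
  simp [wireTarget_last]

theorem crossbarPerm_switch (σ : Perm (Fin (k + 1))) (i : Fin k) (j : Fin (k + 1)) :
    crossbarPerm σ (((σ⁻¹ j).succAbove i, j), 0) = ((i.castSucc, j), 1) := by
  simp only [crossbarPerm, Perm.mul_apply]
  rw [(Perm.inv_eq_iff_eq (y := ((i.castSucc, j), (0 : Fin 2)))).2 (by simp)]
  simp [Fin.castSucc_ne_last]

theorem crossbarPerm_selected_iff (σ : Perm (Fin (k + 1))) (i j : Fin (k + 1)) :
    crossbarPerm σ ((i, j), 0) = ((i, j), 0) ↔ j = σ i := by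
  refine ⟨fun h => ?_, ?_⟩
  · by_contra hne
    have hi : i ≠ σ⁻¹ j := fun e => hne (by rw [e]; simp)
    obtain ⟨i', rfl⟩ := Fin.exists_succAbove_eq hi
    have := h.symm.trans (crossbarPerm_switch σ i' j)
    simp at this
  · rintro rfl
    exact crossbarPerm_selected σ i

theorem crossbarPerm_injective : Function.Injective (crossbarPerm (k := k)) := by
  intro σ τ h
  ext i : 1
  rw [← crossbarPerm_selected_iff, ← h, crossbarPerm_selected]

/-- Any two neighbouring switches of a row are the ends of the edges from some wire. -/
theorem exists_wireTarget_eq (r : Fin (k + 1)) (s : Fin k) :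
    ∃ i j, wireTarget k (Fin.castSucc i, j) = (r, s.castSucc) := by
  obtain ⟨⟨i, j⟩, h⟩ := (wireTarget k).surjective (r, s.castSucc)
  induction i using Fin.lastCases with
  | last =>
    rw [wireTarget_last] at h
    exact absurd (congrArg Prod.snd h).symm (Fin.castSucc_ne_last s)
  | cast i => exact ⟨i, j, h⟩

theorem exists_eq_wireTarget (i : Fin k) (j : Fin (k + 1)) :
    ∃ r s, wireTarget k (Fin.castSucc i, j) = (r, Fin.castSucc s) := by
  obtain ⟨s, hs⟩ := Fin.exists_succAbove_eq (Fin.succAbove_ne j i).symm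
  exact ⟨_, s, wireTarget_castSucc i j s hs⟩

theorem crossbarEdge_wire_iff {i : Fin k} {j r : Fin (k + 1)} {s : Fin k}
    (h : wireTarget k (i.castSucc, j) = (r, s.castSucc)) (q : CrossbarVertex (k + 1)) :
    CrossbarEdge ((i.castSucc, j), 1) q ↔
      q = ((r, s.castSucc), 0) ∨ q = ((r, s.succ), 0) := by
  obtain ⟨s', hs⟩ := Fin.exists_succAbove_eq (Fin.succAbove_ne j i).symm
  rw [wireTarget_castSucc i j s' hs] at h
  obtain rfl := (Prod.mk.inj h).1
  obtain rfl := Fin.castSucc_injective _ (Prod.mk.inj h).2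
  obtain ⟨⟨i', j'⟩, t'⟩ := q
  simp only [CrossbarEdge, Prod.mk.injEq, Fin.ext_iff, Fin.le_def, Fin.lt_def, Fin.val_zero,
    Fin.val_one, Fin.val_castSucc, Fin.val_succ, one_ne_zero, false_and, false_or, true_and]
  have := i.2
  have := s'.2
  rcases lt_or_ge i.castSucc j with hlt | hle
  · rw [Fin.succAbove_of_castSucc_lt _ _ hlt] at hs ⊢
    rcases lt_or_ge s'.castSucc i.castSucc with hlt' | hle'
    · rw [Fin.succAbove_of_castSucc_lt _ _ hlt'] at hs
      simp only [Fin.ext_iff, Fin.lt_def, Fin.val_castSucc] at *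
      constructor <;> intro h <;> omega
    · rw [Fin.succAbove_of_le_castSucc _ _ hle'] at hs
      simp only [Fin.ext_iff, Fin.lt_def, Fin.le_def, Fin.val_castSucc, Fin.val_succ] at *
      constructor <;> intro h <;> omega
  · rw [Fin.succAbove_of_le_castSucc _ _ hle] at hs ⊢
    rcases lt_or_ge s'.castSucc i.succ with hlt' | hle'
    · rw [Fin.succAbove_of_castSucc_lt _ _ hlt'] at hs
      simp only [Fin.ext_iff, Fin.lt_def, Fin.le_def, Fin.val_castSucc, Fin.val_succ] at *
      constructor <;> intro h <;> omega
    · rw [Fin.succAbove_of_le_castSucc _ _ hle'] at hs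
      simp only [Fin.ext_iff, Fin.le_def, Fin.val_castSucc, Fin.val_succ] at *
      constructor <;> intro h <;> omega

theorem crossbarEdge_idle_iff (j : Fin (k + 1)) (q : CrossbarVertex (k + 1)) :
    CrossbarEdge ((Fin.last k, j), 1) q ↔ q = ((Fin.last k, j), 1) := by
  obtain ⟨⟨i', j'⟩, t'⟩ := q
  simp only [CrossbarEdge, Prod.mk.injEq, Fin.ext_iff, Fin.le_def, Fin.lt_def, Fin.val_zero,
    Fin.val_one, Fin.val_last, one_ne_zero, false_and, false_or, true_and, and_true]
  constructor <;> intro h <;> omega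

theorem crossbarEdge_switch_iff (c : Fin (k + 1) × Fin (k + 1)) (q : CrossbarVertex (k + 1)) :
    CrossbarEdge (c, 0) q ↔
      ∃ i : Fin k, q = ((i.castSucc, c.2), 1) ∧ (c.1 = i.castSucc ∨ c.1 = i.succ) := by
  obtain ⟨⟨i', j'⟩, t'⟩ := q
  obtain ⟨i, j⟩ := c
  simp only [CrossbarEdge, Prod.mk.injEq, Fin.ext_iff, Fin.le_def, Fin.lt_def, Fin.val_zero,
    Fin.val_one, Fin.val_castSucc, Fin.val_succ, zero_ne_one, false_and, or_false, true_and]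
  constructor
  · intro h
    obtain ⟨h₁, h₂, h₃⟩ := h
    have hi := i.2
    exact ⟨⟨i', by omega⟩, ⟨⟨rfl, h₂.symm⟩, h₁⟩, by dsimp only; omega⟩
  · rintro ⟨x, h⟩
    omega

/-- A permutation of the vertices of the crossbar is compatible with it if it moves along edges;
here the switches have loops. -/
def CrossbarCompatible (τ : Perm (CrossbarVertex (k + 1))) : Prop :=
  ∀ p, (p.2 = 0 ∧ τ p = p) ∨ CrossbarEdge p (τ p)

theorem crossbarPerm_compatible (σ : Perm (Fin (k + 1))) : CrossbarCompatible (crossbarPerm σ) := by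
  rintro ⟨⟨i, j⟩, t⟩
  fin_cases t
  · by_cases h : j = σ i
    · subst h
      exact Or.inl ⟨rfl, crossbarPerm_selected σ i⟩
    · have hi : i ≠ σ⁻¹ j := fun e => h (by rw [e]; simp)
      obtain ⟨i', rfl⟩ := Fin.exists_succAbove_eq hi
      refine Or.inr ((crossbarEdge_switch_iff _ _).2 ⟨i', crossbarPerm_switch σ i' j, ?_⟩)
      exact (succAbove_eq_or _ _)
  · right
    induction i using Fin.lastCases with
    | last => exact (crossbarEdge_idle_iff _ _).2 (crossbarPerm_idle σ j)
    | cast i =>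
      obtain ⟨r, s, h⟩ := exists_eq_wireTarget i j
      refine (crossbarEdge_wire_iff h _).2 ?_
      have e := crossbarPerm_wire σ i j r s h
      rcases succAbove_eq_or (σ r) s with h' | h'
      · exact Or.inl (e.trans (by rw [h']))
      · exact Or.inr (e.trans (by rw [h']))

theorem CrossbarCompatible.exists_eq_crossbarPerm {τ : Perm (CrossbarVertex (k + 1))}
    (hτ : CrossbarCompatible τ) : ∃ σ, crossbarPerm σ = τ := by
  choose wi wj hw using exists_wireTarget_eq (k := k)
  -- in every row the wires reach all switches but one
  have hrow : ∀ r, ∃ a : Fin (k + 1), ∀ s,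
      τ (((wi r s).castSucc, wj r s), 1) = ((r, a.succAbove s), 0) := by
    intro r
    have h : ∀ s, ∃ y, τ (((wi r s).castSucc, wj r s), 1) = ((r, y), 0) ∧
        (y = s.castSucc ∨ y = s.succ) := by
      intro s
      rcases hτ (((wi r s).castSucc, wj r s), 1) with h | h
      · exact absurd h.1 (by simp)
      · rcases (crossbarEdge_wire_iff (hw r s) _).1 h with h | h
        · exact ⟨_, h, Or.inl rfl⟩
        · exact ⟨_, h, Or.inr rfl⟩
    choose f hf hf' using h
    obtain ⟨a, rfl⟩ := exists_eq_succAbove f (fun s t hst => by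
      have e := τ.injective ((hf s).trans ((by rw [hst] : _ = _).trans (hf t).symm))
      have e' : wireTarget k ((wi r s).castSucc, wj r s) =
          wireTarget k ((wi r t).castSucc, wj r t) := by
        rw [(Prod.mk.inj e).1]
      rw [hw, hw] at e'
      exact Fin.castSucc_injective _ (Prod.mk.inj e').2) hf'
    exact ⟨a, hf⟩
  -- in every column the wires are reached from all switches but one
  have hcol : ∀ j, ∃ b : Fin (k + 1), ∀ i : Fin k,
      τ ((b.succAbove i, j), 0) = ((i.castSucc, j), 1) := by
    intro j
    have h : ∀ i : Fin k, ∃ y, τ ((y, j), 0) = ((i.castSucc, j), 1) ∧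
        (y = i.castSucc ∨ y = i.succ) := by
      intro i
      obtain ⟨⟨⟨x, y⟩, t⟩, hx⟩ := τ.surjective ((i.castSucc, j), 1)
      fin_cases t
      · rcases hτ ((x, y), 0) with h | h
        · exact absurd (h.2.symm.trans hx) (by simp)
        · obtain ⟨i', h₁, h₂⟩ := (crossbarEdge_switch_iff _ _).1 h
          have e := h₁.symm.trans hx
          simp only [Prod.mk.injEq, and_true] at e
          obtain rfl := Fin.castSucc_injective _ e.1
          obtain rfl := e.2
          exact ⟨x, hx, h₂⟩
      · exfalso
        rcases hτ ((x, y), 1) with h | h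
        · exact absurd h.1 (by simp)
        · have hx' : τ ((x, y), 1) = ((i.castSucc, j), 1) := hx
          rw [hx'] at h
          induction x using Fin.lastCases with
          | last =>
            have := (crossbarEdge_idle_iff _ _).1 h
            simp only [Prod.mk.injEq] at this
            exact Fin.castSucc_ne_last _ this.1.1
          | cast x =>
            obtain ⟨r, s, h'⟩ := exists_eq_wireTarget x y
            rcases (crossbarEdge_wire_iff h' _).1 h with h | h <;> simp at h
    choose g hg hg' using h
    obtain ⟨b, rfl⟩ := exists_eq_succAbove g (fun s t hst => by
      have e := (hg s).symm.trans ((by rw [hst] : _ = _).trans (hg t))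
      simpa using e) hg'
    exact ⟨b, hg⟩
  choose a ha using hrow
  choose b hb using hcol
  -- the switch left over in a row, and the one left over in a column, is fixed
  have hfix : ∀ i j, τ ((i, j), 0) = ((i, j), 0) → j = a i ∧ i = b j := by
    intro i j h
    constructor
    · by_contra hne
      obtain ⟨s, rfl⟩ := Fin.exists_succAbove_eq hne
      have := τ.injective ((ha i s).trans h.symm)
      simp at this
    · by_contra hne
      obtain ⟨s, rfl⟩ := Fin.exists_succAbove_eq hne
      have := h.symm.trans (hb j s)
      simp at this
  have ha' : ∀ i, τ ((i, a i), 0) = ((i, a i), 0) := by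
    intro i
    obtain ⟨⟨⟨x, y⟩, t⟩, hx⟩ := τ.surjective ((i, a i), 0)
    fin_cases t
    · rcases hτ ((x, y), 0) with h | h
      · have e := h.2.symm.trans hx
        exact (congrArg τ e.symm).trans hx
      · obtain ⟨i', h₁, -⟩ := (crossbarEdge_switch_iff _ _).1 h
        exact absurd (h₁.symm.trans hx) (by simp)
    · exfalso
      have hx' : τ ((x, y), 1) = ((i, a i), 0) := hx
      rcases hτ ((x, y), 1) with h | h
      · exact absurd h.1 (by simp)
      · induction x using Fin.lastCases with
        | last =>
          have h := (crossbarEdge_idle_iff _ _).1 h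
          exact absurd (h.symm.trans hx') (by simp)
        | cast x =>
          obtain ⟨r, s, h'⟩ := exists_eq_wireTarget x y
          have e : (x.castSucc, y) = ((wi r s).castSucc, wj r s) := by
            apply (wireTarget k).injective
            rw [h', hw]
          rw [e, ha] at hx'
          simp only [Prod.mk.injEq, and_true] at hx'
          obtain ⟨rfl, h⟩ := hx'
          exact Fin.succAbove_ne _ _ h
  have hb' : ∀ j, τ ((b j, j), 0) = ((b j, j), 0) := by
    intro j
    rcases hτ ((b j, j), 0) with h | h
    · exact h.2
    · exfalso
      obtain ⟨i', h₁, -⟩ := (crossbarEdge_switch_iff _ _).1 h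
      have := τ.injective (h₁.trans (hb j i').symm)
      simp only [Prod.mk.injEq, and_true] at this
      exact Fin.succAbove_ne _ _ this.symm
  refine ⟨⟨a, b, fun i => (hfix _ _ (ha' i)).2.symm, fun j => (hfix _ _ (hb' j)).1.symm⟩, ?_⟩
  ext1 ⟨⟨i, j⟩, t⟩
  fin_cases t
  · by_cases h : i = b j
    · subst h
      refine Eq.trans ?_ (hb' j).symm
      exact (crossbarPerm_selected_iff _ _ _).2 (hfix _ _ (hb' j)).1
    · obtain ⟨i', rfl⟩ := Fin.exists_succAbove_eq h
      exact Eq.trans (crossbarPerm_switch _ i' j) (hb j i').symm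
  · induction i using Fin.lastCases with
    | last =>
      refine (crossbarPerm_idle _ j).trans ?_
      rcases hτ ((Fin.last k, j), 1) with h | h
      · exact absurd h.1 (by simp)
      · exact ((crossbarEdge_idle_iff _ _).1 h).symm
    | cast i =>
      obtain ⟨r, s, h'⟩ := exists_eq_wireTarget i j
      have e : (i.castSucc, j) = ((wi r s).castSucc, wj r s) := by
        apply (wireTarget k).injective
        rw [h', hw]
      refine (crossbarPerm_wire _ i j r s h').trans ?_
      have := ha r s
      rw [← e] at this
      exact this.symm

end

/-! ### The Cayley permanent and determinant of the crossbar -/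

theorem ofFn_mul_finProdFinEquiv {α : Type*} {m n : ℕ} (f : Fin (m * n) → α) :
    List.ofFn f =
      (List.ofFn fun i : Fin m =>
        List.ofFn fun j : Fin n => f (finProdFinEquiv (i, j))).flatten := by
  rw [List.ofFn_mul]
  congr 2
  funext i
  congr 1
  funext j
  congr 1
  ext
  simp [finProdFinEquiv, mul_comm, add_comm]

theorem ofFn_crossbarIndex {α : Type*} {n : ℕ} (f : Fin (n * n * 2) → α) :
    List.ofFn f = (List.ofFn fun i : Fin n => (List.ofFn fun j : Fin n =>
      [f (crossbarIndex n ((i, j), 0)), f (crossbarIndex n ((i, j), 1))]).flatten).flatten := by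
  rw [ofFn_mul_finProdFinEquiv, ofFn_mul_finProdFinEquiv, List.flatten_flatten, List.map_ofFn]
  simp only [List.ofFn_succ, List.ofFn_zero]
  rfl

theorem prod_ofFn_ite {M : Type*} [Monoid M] {n : ℕ} (a : Fin n) (x : Fin n → M) :
    (List.ofFn fun j => if j = a then x j else 1).prod = x a := by
  induction n with
  | zero => exact a.elim0
  | succ n ih =>
    rw [List.ofFn_succ, List.prod_cons]
    induction a using Fin.cases with
    | zero =>
      rw [List.prod_eq_one]
      · simp
      · intro y hy
        obtain ⟨j, rfl⟩ := (List.mem_ofFn' _ _).1 hy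
        simp [Fin.succ_ne_zero]
    | succ a =>
      rw [if_neg (Fin.succ_ne_zero a).symm, one_mul]
      simpa using ih a fun j => x j.succ

variable {R : Type*} [Ring R]

/-- The weighted adjacency matrix of the crossbar in which the loops of the switches have the
weights `A i j`. -/
def crossbarMatrix {n : ℕ} (A : Matrix (Fin n) (Fin n) R) :
    Matrix (Fin (n * n * 2)) (Fin (n * n * 2)) R := fun x y =>
  let p := (crossbarIndex n).symm x
  let q := (crossbarIndex n).symm y
  if p.2 = 0 ∧ q = p then A p.1.1 p.1.2 else if CrossbarEdge p q then 1 else 0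

/-- The factors of the term of a permutation `τ` are `1` off the fixed switches. -/
theorem prod_crossbarMatrix_crossbarPerm {k : ℕ} (A : Matrix (Fin (k + 1)) (Fin (k + 1)) R)
    (σ : Perm (Fin (k + 1))) :
    (List.ofFn fun x => crossbarMatrix A x
      ((crossbarIndex (k + 1)).permCongr (crossbarPerm σ) x)).prod =
    (List.ofFn fun i => A i (σ i)).prod := by
  rw [ofFn_crossbarIndex, List.prod_flatten, List.map_ofFn]
  congr 2
  funext i
  rw [Function.comp_apply, List.prod_flatten, List.map_ofFn, ← prod_ofFn_ite (σ i) (A i)]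
  congr 2
  funext j
  have h₁ := crossbarPerm_compatible σ ((i, j), 1)
  have h₀ := crossbarPerm_compatible σ ((i, j), 0)
  have hs := crossbarPerm_selected_iff σ i j
  simp only [one_ne_zero, false_and, false_or] at h₁
  simp only [Function.comp_apply, List.prod_cons, List.prod_nil, mul_one, crossbarMatrix,
    permCongr_apply, symm_apply_apply, one_ne_zero, false_and, if_false, if_pos h₁, hs, true_and]
  split_ifs with h h'
  · rfl
  · rfl
  · exact absurd (h₀.resolve_left fun e => h (hs.1 e.2)) h'

theorem prod_crossbarMatrix_eq_zero {k : ℕ} (A : Matrix (Fin (k + 1)) (Fin (k + 1)) R)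
    (τ : Perm (CrossbarVertex (k + 1))) (hτ : ∀ σ, crossbarPerm σ ≠ τ) :
    (List.ofFn fun x => crossbarMatrix A x ((crossbarIndex (k + 1)).permCongr τ x)).prod = 0 := by
  have h : ¬CrossbarCompatible τ := fun h => by
    obtain ⟨σ, hσ⟩ := h.exists_eq_crossbarPerm
    exact hτ σ hσ
  obtain ⟨p, hp⟩ := not_forall.1 h
  obtain ⟨h₁, h₂⟩ := not_or.1 hp
  refine List.prod_eq_zero ((List.mem_ofFn' _ _).2 ⟨crossbarIndex (k + 1) p, ?_⟩)
  simp only [crossbarMatrix, permCongr_apply, symm_apply_apply]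
  rw [if_neg h₁, if_neg h₂]

/-- A signed or unsigned sum over the permutations of the crossbar is one over those of `G`. -/
theorem sum_crossbarMatrix {n : ℕ} (A : Matrix (Fin n) (Fin n) R)
    (w : ∀ {m : ℕ}, Perm (Fin m) → ℤˣ) (h₀ : ∀ σ : Perm (Fin 0), w σ = 1)
    (hw : ∀ (k : ℕ) (σ : Perm (Fin (k + 1))),
      w ((crossbarIndex (k + 1)).permCongr (crossbarPerm σ)) = w σ) :
    ∑ τ : Perm (Fin (n * n * 2)), w τ • (List.ofFn fun x => crossbarMatrix A x (τ x)).prod =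
      ∑ σ : Perm (Fin n), w σ • (List.ofFn fun i => A i (σ i)).prod := by
  cases n with
  | zero =>
    change ∑ τ : Perm (Fin 0), _ = _
    simp [h₀]
  | succ k =>
    symm
    refine Finset.sum_of_injOn (fun σ => (crossbarIndex (k + 1)).permCongr (crossbarPerm σ))
      (fun σ _ τ _ h => crossbarPerm_injective ((crossbarIndex (k + 1)).permCongr.injective h))
      (fun _ _ => Finset.mem_coe.2 (Finset.mem_univ _)) ?_ ?_
    · intro τ _ hτ
      obtain ⟨τ, rfl⟩ := (crossbarIndex (k + 1)).permCongr.surjective τ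
      rw [prod_crossbarMatrix_eq_zero A τ, smul_zero]
      rintro σ rfl
      exact hτ ⟨σ, by simp, rfl⟩
    · intro σ _
      rw [hw, prod_crossbarMatrix_crossbarPerm]

theorem cayleyPerm_crossbarMatrix {n : ℕ} (A : Matrix (Fin n) (Fin n) R) :
    cayleyPerm (crossbarMatrix A) = cayleyPerm A := by
  simpa [cayleyPerm] using sum_crossbarMatrix A (fun _ => 1) (fun _ => rfl) fun _ _ => rfl

theorem cayleyDet_crossbarMatrix {n : ℕ} (A : Matrix (Fin n) (Fin n) R) :
    cayleyDet (crossbarMatrix A) = cayleyDet A := by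
  refine sum_crossbarMatrix A (fun σ => Perm.sign σ) (fun σ => by
    rw [Subsingleton.elim σ 1, Perm.sign_one]) fun k σ => ?_
  rw [Perm.sign_permCongr, sign_crossbarPerm]

namespace CodedDigraph

theorem weightMatrix_crossbar {one : List Bool} {c : List Bool → Option R} (hone : c one = some 1)
    (G : CodedDigraph) : (G.crossbar one).weightMatrix c = crossbarMatrix (G.weightMatrix c) := by
  funext x y
  simp only [weightMatrix, crossbar, crossbarMatrix]
  split_ifs <;> simp [hone]

theorem hasWeightsIn_crossbar {one : List Bool} {c : List Bool → Option R} (hone : c one = some 1)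
    {G : CodedDigraph} (hG : G.HasWeightsIn c) : (G.crossbar one).HasWeightsIn c := by
  intro x y w h
  simp only [crossbar] at h
  split_ifs at h
  · exact hG _ _ _ h
  · rw [← Option.some.inj h, hone]
    simp

theorem isManyOneReduction_crossbar_perm {one : List Bool} {c : List Bool → Option R}
    (hone : c one = some 1) : IsManyOneReduction (crossbar one) (CPerm c) (planarCPerm c) := by
  rintro G v ⟨hG, rfl⟩
  refine ⟨⟨hasWeightsIn_crossbar hone hG, crossbar_isPlanar one G⟩, ?_⟩
  change cayleyPerm ((G.crossbar one).weightMatrix c) = cayleyPerm (G.weightMatrix c)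
  rw [weightMatrix_crossbar hone]
  exact cayleyPerm_crossbarMatrix _

theorem isManyOneReduction_crossbar_det {one : List Bool} {c : List Bool → Option R}
    (hone : c one = some 1) : IsManyOneReduction (crossbar one) (CDet c) (planarCDet c) := by
  rintro G v ⟨hG, rfl⟩
  refine ⟨⟨hasWeightsIn_crossbar hone hG, crossbar_isPlanar one G⟩, ?_⟩
  change cayleyDet ((G.crossbar one).weightMatrix c) = cayleyDet (G.weightMatrix c)
  rw [weightMatrix_crossbar hone]
  exact cayleyDet_crossbarMatrix _

end CodedDigraph

end

/-! ### Structured programs for stack machines -/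

/-- A structured program for a machine with the stacks `Γ k` and the internal state `σ`. -/
inductive StackProgram {K : Type} (Γ : K → Type) (σ : Type) : Type
  /-- a statement that is executed in one step; its jumps only mark where it ends -/
  | atom (q : Turing.TM2.Stmt Γ Unit σ) : StackProgram Γ σ
  /-- one program after another -/
  | seq (p q : StackProgram Γ σ) : StackProgram Γ σ
  /-- repetition of a program as long as the internal state passes a test -/
  | loop (b : σ → Bool) (p : StackProgram Γ σ) : StackProgram Γ σ

namespace StackProgram

open Turing Turing.TM2

variable {K : Type} {Γ : K → Type} {σ : Type}

/-- The labels of the machine that executes a program: one for every atom and one for the test of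
every loop. -/
def Label : StackProgram Γ σ → Type
  | atom _ => Unit
  | seq p q => p.Label ⊕ q.Label
  | loop _ p => Option p.Label

instance fintypeLabel : ∀ p : StackProgram Γ σ, Fintype p.Label
  | atom _ => inferInstanceAs (Fintype Unit)
  | seq p q => @instFintypeSum _ _ (fintypeLabel p) (fintypeLabel q)
  | loop _ p => @instFintypeOption _ (fintypeLabel p)

/-- The label at which the execution of a program begins. -/
def entry : ∀ p : StackProgram Γ σ, p.Label
  | atom _ => ()
  | seq p _ => Sum.inl p.entry
  | loop _ _ => none

/-- The jump to a label, or the halt. -/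
def exitStmt {Λ : Type} : Option Λ → Stmt Γ Λ σ
  | none => .halt
  | some l => .goto fun _ => l

/-- The statement `q` with all its jumps replaced by `exitStmt e`. -/
def redirect {Λ : Type} (e : Option Λ) : Stmt Γ Unit σ → Stmt Γ Λ σ
  | .push k f q => .push k f (redirect e q)
  | .peek k f q => .peek k f (redirect e q)
  | .pop k f q => .pop k f (redirect e q)
  | .load f q => .load f (redirect e q)
  | .branch f q₁ q₂ => .branch f (redirect e q₁) (redirect e q₂)
  | .goto _ => exitStmt e
  | .halt => exitStmt e

/-- The statements that execute a program whose labels are embedded by `ι` into those of a machine,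
and that jump to `e` at the end. -/
def code : ∀ (p : StackProgram Γ σ) {Λ : Type}, (p.Label → Λ) → Option Λ → p.Label → Stmt Γ Λ σ
  | atom q, _, _, e, _ => redirect e q
  | seq p q, _, ι, _, Sum.inl l =>
    code p (fun l => ι (Sum.inl l)) (some (ι (Sum.inr q.entry))) l
  | seq _ q, _, ι, e, Sum.inr l => code q (fun l => ι (Sum.inr l)) e l
  | loop b p, _, ι, e, none => .branch b (.goto fun _ => ι (some p.entry)) (exitStmt e)
  | loop _ p, _, ι, _, some l => code p (fun l => ι (some l)) (some (ι none)) l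

variable [DecidableEq K]

/-- `Exec p a t b` means that the program `p`, started with the internal state and the stacks `a`,
ends within `t` steps with those of `b`. -/
inductive Exec : StackProgram Γ σ → σ × (∀ k, List (Γ k)) → ℕ → σ × (∀ k, List (Γ k)) → Prop
  | atom {q s S s' S'} (hs : (stepAux q s S).var = s') (hS : ∀ k, (stepAux q s S).stk k = S' k) :
    Exec (atom q) (s, S) 1 (s', S')
  | seq {p q a b c t u} (h : Exec p a t b) (h' : Exec q b u c) : Exec (seq p q) a (t + u) c
  | loop_false {b p a} (h : b a.1 = false) : Exec (loop b p) a 1 a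
  | loop_true {b p a c d t u} (h : b a.1 = true) (h' : Exec p a t c) (h'' : Exec (loop b p) c u d) :
    Exec (loop b p) a (t + 1 + u) d
  | mono {p a b t u} (h : Exec p a t b) (htu : t ≤ u) : Exec p a u b

theorem stepAux_exitStmt {Λ : Type} (e : Option Λ) (s : σ) (S : ∀ k, List (Γ k)) :
    stepAux (exitStmt e) s S = ⟨e, s, S⟩ := by
  cases e <;> rfl

theorem stepAux_redirect {Λ : Type} (e : Option Λ) (q : Stmt Γ Unit σ) (s : σ)
    (S : ∀ k, List (Γ k)) :
    stepAux (redirect e q) s S = ⟨e, (stepAux q s S).var, (stepAux q s S).stk⟩ := by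
  induction q generalizing s S with
  | push k f q ih => exact ih _ _
  | peek k f q ih => exact ih _ _
  | pop k f q ih => exact ih _ _
  | load f q ih => exact ih _ _
  | branch f q₁ q₂ ih₁ ih₂ =>
    simp only [redirect, stepAux]
    cases f s
    · exact ih₂ _ _
    · exact ih₁ _ _
  | goto f => exact stepAux_exitStmt e s S
  | halt => exact stepAux_exitStmt e s S

theorem flip_bind_some {α : Type} (f : α → Option α) (a : α) : flip bind f (some a) = f a := rfl

/-- A machine that contains the code of a program executes the program. -/
theorem Exec.iterate_step {p : StackProgram Γ σ} {a b : σ × (∀ k, List (Γ k))} {t : ℕ}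
    (h : Exec p a t b) {Λ : Type} (M : Λ → Stmt Γ Λ σ) (ι : p.Label → Λ) (e : Option Λ)
    (hM : ∀ l, M (ι l) = p.code ι e l) :
    ∃ n ≤ t, (flip bind (step M))^[n] (some ⟨some (ι p.entry), a.1, a.2⟩) =
      some (⟨e, b.1, b.2⟩ : Cfg Γ Λ σ) := by
  induction h generalizing Λ with
  | @atom q s S s' S' hs hS =>
    refine ⟨1, le_rfl, ?_⟩
    rw [Function.iterate_one, flip_bind_some, step, hM]
    change some (stepAux (redirect e q) s S) = _
    rw [stepAux_redirect, hs, funext hS]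
  | @seq p q a b c t u _ _ ih₁ ih₂ =>
    obtain ⟨m, hm, h₁⟩ := ih₁ M (fun l => ι (Sum.inl l)) (some (ι (Sum.inr q.entry)))
      fun l => hM (Sum.inl l)
    obtain ⟨n, hn, h₂⟩ := ih₂ M (fun l => ι (Sum.inr l)) e fun l => hM (Sum.inr l)
    refine ⟨n + m, by omega, ?_⟩
    rw [Function.iterate_add_apply]
    exact (congrArg _ h₁).trans h₂
  | @loop_false b p a h =>
    refine ⟨1, le_rfl, ?_⟩
    rw [Function.iterate_one, flip_bind_some, step, hM]
    change some (cond (b a.1) _ (stepAux (exitStmt e) a.1 a.2)) = _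
    rw [h, stepAux_exitStmt]
    rfl
  | @loop_true b p a c d t u h _ _ ih₁ ih₂ =>
    obtain ⟨m, hm, h₁⟩ := ih₁ M (fun l => ι (some l)) (some (ι none)) fun l => hM (some l)
    obtain ⟨n, hn, h₂⟩ := ih₂ M ι e hM
    refine ⟨n + (m + 1), by omega, ?_⟩
    have h₀ : (flip bind (step M)) (some ⟨some (ι (entry (loop b p))), a.1, a.2⟩) =
        some ⟨some (ι (some p.entry)), a.1, a.2⟩ := by
      rw [flip_bind_some, step, hM]
      change some (cond (b a.1) _ (stepAux (exitStmt e) a.1 a.2)) = _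
      rw [h]
      rfl
    rw [Function.iterate_add_apply, Function.iterate_add_apply, Function.iterate_one, h₀]
    exact (congrArg _ h₁).trans h₂
  | mono _ htu ih =>
    obtain ⟨n, hn, h⟩ := ih M ι e hM
    exact ⟨n, hn.trans htu, h⟩

/-- A loop that treats the elements of a list one by one. The states are given by the list of the
treated elements, in reverse order, and the list of the remaining ones. -/
theorem Exec.loop_list {b : σ → Bool} {p : StackProgram Γ σ} {α : Type} (l : List α)
    (st : List α → List α → σ × (∀ k, List (Γ k))) (t : ℕ)
    (hT : ∀ r a l', l = r.reverse ++ a :: l' →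
      b (st r (a :: l')).1 = true ∧ Exec p (st r (a :: l')) t (st (a :: r) l'))
    (hF : b (st l.reverse []).1 = false) :
    Exec (loop b p) (st [] l) (l.length * (t + 1) + 1) (st l.reverse []) := by
  have key : ∀ r l', l = r.reverse ++ l' →
      Exec (loop b p) (st r l') (l'.length * (t + 1) + 1) (st l.reverse []) := by
    intro r l' h
    induction l' generalizing r with
    | nil =>
      rw [List.append_nil] at h
      subst h
      rw [List.reverse_reverse] at hF ⊢
      exact (Exec.loop_false hF).mono (by simp)
    | cons a l' ih =>
      obtain ⟨h₁, h₂⟩ := hT r a l' h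
      refine (Exec.loop_true h₁ h₂ (ih (a :: r) (by simpa using h))).mono ?_
      rw [List.length_cons]
      ring_nf
      omega
  exact key [] l (by simp)

/-- The machine that executes a program. -/
def machine (p : StackProgram Γ σ) [Fintype K] [Fintype σ] (s₀ : σ) (k₀ k₁ : K)
    [Fintype (Γ k₀)] : FinTM2 where
  K := K
  k₀ := k₀
  k₁ := k₁
  Γ := Γ
  Λ := p.Label
  main := p.entry
  σ := σ
  initialState := s₀
  m := p.code id none

theorem dite_eq_update (k₀ : K) (l : List (Γ k₀)) (k : K) :
    (if h : k = k₀ then (by rw [h]; exact l) else [] : List (Γ k)) =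
      Function.update (fun _ => []) k₀ l k := by
  by_cases h : k = k₀
  · subst h
    rw [Function.update_self]
    exact dif_pos rfl
  · rw [Function.update_of_ne h]
    exact dif_neg h

theorem initList_machine (p : StackProgram Γ σ) [Fintype K] [Fintype σ] (s₀ : σ) (k₀ k₁ : K)
    [Fintype (Γ k₀)] (l : List (Γ k₀)) :
    initList (p.machine s₀ k₀ k₁) l =
      ⟨some p.entry, s₀, Function.update (fun _ => []) k₀ l⟩ := by
  exact congrArg (fun S => Cfg.mk _ _ S) (funext fun k => dite_eq_update k₀ l k)

theorem haltList_machine (p : StackProgram Γ σ) [Fintype K] [Fintype σ] (s₀ : σ) (k₀ k₁ : K)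
    [Fintype (Γ k₀)] (l : List (Γ k₁)) :
    haltList (p.machine s₀ k₀ k₁) l = ⟨none, s₀, Function.update (fun _ => []) k₁ l⟩ := by
  exact congrArg (fun S => Cfg.mk _ _ S) (funext fun k => dite_eq_update k₁ l k)

/-- A function is computable in polynomial time if a structured program computes it within a
polynomial number of steps. -/
theorem computableInPolyTime (p : StackProgram Γ σ) [Fintype K] [Fintype σ] (s₀ : σ) (k₀ k₁ : K)
    [Fintype (Γ k₀)] {α β Γ₀ Γ₁ : Type} (e₀ : Γ k₀ ≃ Γ₀) (e₁ : Γ k₁ ≃ Γ₁) {ea : α → List Γ₀}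
    {eb : β → List Γ₁} {f : α → β} (time : Polynomial ℕ)
    (h : ∀ a, Exec p (s₀, Function.update (fun _ => []) k₀ ((ea a).map e₀.symm))
      (time.eval (ea a).length)
      (s₀, Function.update (fun _ => []) k₁ ((eb (f a)).map e₁.symm))) :
    Nonempty (TM2ComputableInPolyTime ea eb f) := by
  refine ⟨{ tm := p.machine s₀ k₀ k₁, inputAlphabet := e₀, outputAlphabet := e₁, time := time,
            outputsFun := fun a => Classical.choice ?_ }⟩
  obtain ⟨n, hn, h'⟩ := (h a).iterate_step (p.code id none) id none fun _ => rfl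
  refine ⟨⟨⟨n, ?_⟩, hn⟩⟩
  have h₀ := initList_machine p s₀ k₀ k₁ ((ea a).map e₀.symm)
  have h₁ := haltList_machine p s₀ k₀ k₁ ((eb (f a)).map e₁.symm)
  refine Eq.trans (congrArg (fun c => (flip bind _)^[n] (some c)) h₀) ?_
  refine Eq.trans h' (congrArg some h₁.symm)

end StackProgram

/-! ### A program that writes the crossbar -/

namespace CrossbarMachine

open Computability Turing.TM2 StackProgram CodedDigraph

/-- What the machine knows about the number of a row or a column: whether it is the first, the
second, the last one. -/
abbrev LineMark : Type := Bool × Bool × Bool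

/-- What the machine knows about a place: the marks of its row and its column, and whether it is on
or below the diagonal. -/
abbrev PlaceMark : Type := (LineMark × LineMark) × Bool

/-- The stacks: the input, and a copy of it in reverse order; the rows, first being counted and then
with their marks; the columns, with their relation to the diagonal in the row under consideration;
the places; the places relative to the place under consideration; the places that are left to be
treated; the output in reverse order and the output. -/
inductive Stack : Type
  | inp | tmp | cnt | rows | cols | colsAux | cells | marks | marksAux | todo | acc | out
  deriving DecidableEq

instance : Fintype Stack :=
  Fintype.ofList [.inp, .tmp, .cnt, .rows, .cols, .colsAux, .cells, .marks, .marksAux, .todo, .acc,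
    .out] fun k => by cases k <;> simp

/-- The alphabets of the stacks. -/
abbrev Symb : Stack → Type
  | .inp | .tmp | .acc | .out => Γ'
  | .cnt | .rows => LineMark
  | .cols | .colsAux => LineMark × Bool
  | .cells | .marks | .marksAux | .todo => PlaceMark

instance : Fintype (Symb .inp) := inferInstanceAs (Fintype Γ')

/-- The internal state: the elements popped last from stacks of the several kinds, the mark of the
place under consideration, and two bits. -/
structure Registers : Type where
  sym : Option Γ'
  line : Option LineMark
  col : Option (LineMark × Bool)
  mark : Option PlaceMark
  place : Option PlaceMark
  flag : Bool × Bool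

noncomputable instance : Fintype Registers :=
  Fintype.ofInjective (fun r => (r.sym, r.line, r.col, r.mark, r.place, r.flag)) <| by
    rintro ⟨⟩ ⟨⟩ h
    simpa using h

/-- The internal state at the beginning and at the end. -/
def Registers.initial : Registers := ⟨none, none, none, none, none, false, false⟩

/-- The contents of the stacks. -/
structure Memory : Type where
  inp : List Γ' := []
  tmp : List Γ' := []
  cnt : List LineMark := []
  rows : List LineMark := []
  cols : List (LineMark × Bool) := []
  colsAux : List (LineMark × Bool) := []
  cells : List PlaceMark := []
  marks : List PlaceMark := []
  marksAux : List PlaceMark := []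
  todo : List PlaceMark := []
  acc : List Γ' := []
  out : List Γ' := []

/-- The contents of the stacks as a function. -/
def Memory.stk (m : Memory) : ∀ k, List (Symb k)
  | .inp => m.inp
  | .tmp => m.tmp
  | .cnt => m.cnt
  | .rows => m.rows
  | .cols => m.cols
  | .colsAux => m.colsAux
  | .cells => m.cells
  | .marks => m.marks
  | .marksAux => m.marksAux
  | .todo => m.todo
  | .acc => m.acc
  | .out => m.out

/-- The statements of the machine without jumps. -/
abbrev Block : Type := Stmt Symb Unit Registers

/-- Programs with these stacks and this internal state. -/
abbrev Prog : Type := StackProgram Symb Registers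

/-- A loop over the elements of a stack: `pop` pops the next one, `has` tells whether there was one,
and `p` treats it. -/
def forEach (pop : Block → Block) (has : Registers → Bool) (p : Prog) : Prog :=
  seq (atom (pop .halt)) (loop has p)

def popInp : Block → Block := .pop .inp fun r o => { r with sym := o }
def popTmp : Block → Block := .pop .tmp fun r o => { r with sym := o }
def popAcc : Block → Block := .pop .acc fun r o => { r with sym := o }
def popCnt : Block → Block := .pop .cnt fun r o => { r with line := o }
def popRows : Block → Block := .pop .rows fun r o => { r with line := o }
def popCols : Block → Block := .pop .cols fun r o => { r with col := o }
def popColsAux : Block → Block := .pop .colsAux fun r o => { r with col := o }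
def popCells : Block → Block := .pop .cells fun r o => { r with mark := o }
def popMarks : Block → Block := .pop .marks fun r o => { r with mark := o }
def popMarksAux : Block → Block := .pop .marksAux fun r o => { r with mark := o }
def popTodo : Block → Block := .pop .todo fun r o => { r with place := o }

def hasSym (r : Registers) : Bool := r.sym.isSome
def hasLine (r : Registers) : Bool := r.line.isSome
def hasCol (r : Registers) : Bool := r.col.isSome
def hasMark (r : Registers) : Bool := r.mark.isSome
def hasPlace (r : Registers) : Bool := r.place.isSome

def Registers.getSym (r : Registers) : Γ' := r.sym.getD .blank
def Registers.getLine (r : Registers) : LineMark := r.line.getD default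
def Registers.getCol (r : Registers) : LineMark × Bool := r.col.getD default
def Registers.getMark (r : Registers) : PlaceMark := r.mark.getD default
def Registers.getPlace (r : Registers) : PlaceMark := r.place.getD default

/-- Move the input to `tmp` and push a mark on `cnt` for every comma, that is, for every row. -/
def countRows : Prog :=
  seq (atom (.load (fun r => { r with flag := (true, false) }) .halt)) <|
  forEach popInp hasSym <| atom <|
    .push .tmp Registers.getSym <|
    .branch (fun r => r.getSym = .comma)
      (.push .cnt (fun r => (r.flag.1, r.flag.2, false)) <|
        .load (fun r => { r with flag := (false, r.flag.1) }) <| popInp .halt)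
      (popInp .halt)

/-- Move the input back without the commas. -/
def restoreInput : Prog :=
  forEach popTmp hasSym <| atom <|
    .branch (fun r => r.getSym = .comma) (popTmp .halt)
      (.push .inp Registers.getSym <| popTmp .halt)

/-- Mark the last row, and prepare the columns for the first row. -/
def markLast : Prog :=
  seq (atom (.load (fun r => { r with flag := (true, false) }) .halt)) <|
  forEach popCnt hasLine <| atom <|
    .push .rows (fun r => (r.getLine.1, r.getLine.2.1, r.flag.1)) <|
    .push .cols (fun r => ((r.getLine.1, r.getLine.2.1, r.flag.1), r.getLine.1)) <|
    .load (fun r => { r with flag := (false, false) }) <| popCnt .halt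

/-- Push the places of one row, and prepare the columns for the next one: there the diagonal has
moved by one place. -/
def buildRow : Prog :=
  seq
    (seq (atom (.load (fun r => { r with flag := (true, false) }) .halt)) <|
    forEach popCols hasCol <| atom <|
      .push .cells (fun r => ((r.getLine, r.getCol.1), r.getCol.2)) <|
      .push .colsAux (fun r => (r.getCol.1, r.flag.1)) <|
      .load (fun r => { r with flag := (r.getCol.2, false) }) <| popCols .halt) <|
  forEach popColsAux hasCol <| atom <| .push .cols Registers.getCol <| popColsAux .halt

/-- Push all places, row by row. -/
def buildCells : Prog :=
  seq (forEach popRows hasLine <| seq buildRow <| atom <| popRows .halt) <|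
  forEach popCols hasCol <| atom <| popCols .halt

/-- Copy the places to `marks` and `todo`. -/
def copyCells : Prog :=
  forEach popCells hasMark <| atom <|
    .push .marks Registers.getMark <| .push .todo Registers.getMark <| popCells .halt

/-- The relative place is the place itself. -/
def isHere (c : PlaceMark) : Bool := c.1.1.1 && c.1.2.1
/-- The relative place is the one below. -/
def isBelow (c : PlaceMark) : Bool := c.1.1.2.1 && c.1.2.1
/-- The relative place is the one below to the right. -/
def isBelowRight (c : PlaceMark) : Bool := c.1.1.2.1 && c.1.2.2.1
/-- The relative place is the one to the left: this is the last place, cyclically. -/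
def isLeft (c : PlaceMark) : Bool := c.1.1.2.2 && c.1.2.2.2
/-- The relative place is the one above: this is the first place of the last row, cyclically. -/
def isAbove (c : PlaceMark) : Bool := c.1.1.2.2 && c.1.2.1
/-- The place is in the first row. -/
def inFirstRow (c : PlaceMark) : Bool := c.1.1.1
/-- The place is in the last row. -/
def inLastRow (c : PlaceMark) : Bool := c.1.1.2.2
/-- The place is on or below the diagonal. -/
def notAboveDiagonal (c : PlaceMark) : Bool := c.2

/-- There is an edge from the switch of the place `c` to the wire of the relative place `d`. -/
def switchToWire (c d : PlaceMark) : Bool :=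
  (isHere d && !inLastRow c) || (isAbove d && !inFirstRow c)

/-- There is an edge from the wire of the place `c` to the switch of the relative place `d`. -/
def wireToSwitch (c d : PlaceMark) : Bool :=
  !inLastRow c && cond (notAboveDiagonal c) (isBelow d || isBelowRight d) (isHere d || isLeft d)

/-- There is an edge from the wire of the place `c` to the wire of the relative place `d`. -/
def wireToWire (c d : PlaceMark) : Bool := isHere d && inLastRow c

/-- The entry of the adjacency matrix for an edge of weight `1`, or for no edge. -/
def edgeWord (one : List Bool) (b : Bool) : List Γ' := encodeEntry (if b then some one else none)

/-- Push a word on `acc` and go on with `q`. -/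
def pushWord (w : List Γ') (q : Block) : Block := w.foldr (fun s q => .push .acc (fun _ => s) q) q

/-- Write the entry for an edge of weight `1` if the test succeeds, or else for no edge. -/
def emitEdge (one : List Bool) (b : PlaceMark → PlaceMark → Bool) (q : Block) : Block :=
  .branch (fun r => b r.getPlace r.getMark) (pushWord (edgeWord one true) q)
    (pushWord (edgeWord one false) q)

/-- An entry of the input has been begun but not yet been copied completely. -/
def isCopying (r : Registers) : Bool :=
  match r.sym with
  | some .bra | some (.bit _) => true
  | _ => false

/-- Write the entry in the column of a switch in the row of a switch: for the loop the next entry of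
the input is copied, and there is no other edge. -/
def copyEntry : Prog :=
  seq (atom <| .branch (fun r => isHere r.getMark)
    (popInp <| .push .acc Registers.getSym .halt)
    (.load (fun r => { r with sym := none }) <| .push .acc (fun _ => .blank) .halt)) <|
  loop isCopying <| atom <| popInp <| .push .acc Registers.getSym .halt

/-- Write the entries of the row of a switch. -/
def switchRow (one : List Bool) : Prog :=
  seq (forEach popMarks hasMark <|
    seq copyEntry <|
    atom <| emitEdge one switchToWire <| .load (fun r => { r with sym := none }) <|
      .push .marksAux Registers.getMark <| popMarks .halt) <|
  atom <| .push .acc (fun _ => .comma) .halt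

/-- Write the entries of the row of a wire. -/
def wireRow (one : List Bool) : Prog :=
  seq (forEach popMarks hasMark <|
    atom <| emitEdge one wireToSwitch <| emitEdge one wireToWire <|
      .push .marksAux Registers.getMark <| popMarks .halt) <|
  atom <| .push .acc (fun _ => .comma) .halt

/-- Move the relative places back. -/
def restoreMarks : Prog :=
  forEach popMarksAux hasMark <| atom <| .push .marks Registers.getMark <| popMarksAux .halt

/-- Move the relative places back, and rotate them by one place. -/
def rotateMarks : Prog :=
  seq (atom <| .pop .marksAux (fun r o => { r with place := o }) .halt) <|
  seq restoreMarks <|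
  atom <| .push .marks Registers.getPlace .halt

/-- Write all rows. -/
def writeRows (one : List Bool) : Prog :=
  forEach popTodo hasPlace <|
    seq (switchRow one) <| seq restoreMarks <| seq (wireRow one) <| seq rotateMarks <|
    atom <| popTodo .halt

/-- Clear the stacks that are still in use, and reverse the output. -/
def finish : Prog :=
  seq (forEach popMarks hasMark <| atom <| popMarks .halt) <|
  seq (forEach popAcc hasSym <| atom <| .push .out Registers.getSym <| popAcc .halt) <|
  atom <| .load (fun _ => Registers.initial) .halt

/-- The whole program. -/
def crossbarProgram (one : List Bool) : Prog :=
  seq countRows <| seq restoreInput <| seq markLast <| seq buildCells <| seq copyCells <|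
  seq (writeRows one) finish

/-! ### What the parts of the program do -/

/-- The rule for loops over the elements of a stack: `st u v` describes the state when the elements
of `u`, in reverse order, have been treated and those of `v` are left. -/
theorem exec_forEach {pop : Block → Block} {has : Registers → Bool} {p : Prog} {α : Type}
    (l : List α) (st : List α → List α → Registers × (∀ k, List (Symb k))) (t : ℕ)
    {a : Registers × (∀ k, List (Symb k))} (h₀ : Exec (atom (pop .halt)) a 1 (st [] l))
    (hT : ∀ r a l', l = r.reverse ++ a :: l' →
      has (st r (a :: l')).1 = true ∧ Exec p (st r (a :: l')) t (st (a :: r) l'))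
    (hF : has (st l.reverse []).1 = false) :
    Exec (forEach pop has p) a (l.length * (t + 1) + 2) (st l.reverse []) :=
  (Exec.seq h₀ (Exec.loop_list l st t hT hF)).mono (by omega)

theorem exec_restoreMarks (r : Registers) (m : Memory) (l x : List PlaceMark) :
    Exec restoreMarks (r, { m with marksAux := l, marks := x }.stk) (l.length * 2 + 2)
      ({ r with mark := none }, { m with marksAux := [], marks := l.reverse ++ x }.stk) := by
  refine exec_forEach (has := hasMark) l (fun u v => ({ r with mark := v.head? },
    { m with marksAux := v.tail, marks := u ++ x }.stk)) 1 ?_ ?_ rfl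
  · exact Exec.atom rfl fun k => by cases k <;> rfl
  · intro u a v _
    exact ⟨rfl, Exec.atom rfl fun k => by cases k <;> rfl⟩

theorem exec_rotateMarks (r : Registers) (m : Memory) (a : PlaceMark) (l : List PlaceMark) :
    Exec rotateMarks (r, { m with marksAux := a :: l, marks := [] }.stk) (l.length * 2 + 4)
      ({ r with mark := none, place := some a },
        { m with marksAux := [], marks := a :: l.reverse }.stk) := by
  refine (Exec.seq (b := ({ r with place := some a }, { m with marksAux := l, marks := [] }.stk))
    ?_ <| Exec.seq (exec_restoreMarks _ m l []) (Exec.atom rfl ?_)).mono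
    (t := 1 + (l.length * 2 + 2 + 1)) (by omega)
  · exact Exec.atom rfl fun k => by cases k <;> rfl
  · intro k
    cases k <;> simp [stepAux, Memory.stk, Registers.getPlace, Function.update]

theorem exec_copyCells (r : Registers) (m : Memory) (l : List PlaceMark) :
    Exec copyCells (r, { m with cells := l, marks := [], todo := [] }.stk) (l.length * 2 + 2)
      ({ r with mark := none },
        { m with cells := [], marks := l.reverse, todo := l.reverse }.stk) := by
  refine exec_forEach (has := hasMark) l (fun u v => ({ r with mark := v.head? },
    { m with cells := v.tail, marks := u, todo := u }.stk)) 1 ?_ ?_ rfl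
  · exact Exec.atom rfl fun k => by cases k <;> rfl
  · intro u a v _
    exact ⟨rfl, Exec.atom rfl fun k => by cases k <;> rfl⟩

/-- The mark of the row or column `i`. -/
def lineMark (n i : ℕ) : LineMark := (i = 0, i = 1, i + 1 = n)

theorem exec_countRows (m : Memory) (l : List Γ') :
    Exec countRows (Registers.initial, { m with inp := l, tmp := [], cnt := [] }.stk)
      (l.length * 2 + 3)
      ({ Registers.initial with flag := (l.count Γ'.comma = 0, l.count Γ'.comma = 1) },
        { m with inp := [], tmp := l.reverse,
                 cnt := ((List.range (l.count Γ'.comma)).map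
                   fun i => ((i = 0 : Bool), (i = 1 : Bool), false)).reverse }.stk) := by
  have h := exec_forEach (pop := popInp) (has := hasSym) (p := atom <|
    .push .tmp Registers.getSym <|
    .branch (fun r => r.getSym = .comma)
      (.push .cnt (fun r => (r.flag.1, r.flag.2, false)) <|
        .load (fun r => { r with flag := (false, r.flag.1) }) <| popInp .halt)
      (popInp .halt)) l
    (fun u v => ({ Registers.initial with
        sym := v.head?, flag := (u.count Γ'.comma = 0, u.count Γ'.comma = 1) },
      { m with inp := v.tail, tmp := u, cnt := ((List.range (u.count Γ'.comma)).map
                   fun i => ((i = 0 : Bool), (i = 1 : Bool), false)).reverse }.stk)) 1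
    (a := ({ Registers.initial with flag := (true, false) },
      { m with inp := l, tmp := [], cnt := [] }.stk))
    (Exec.atom rfl fun k => by cases k <;> rfl) ?_ rfl
  · rw [List.count_reverse] at h
    refine (Exec.seq (Exec.atom rfl fun k => ?_) h).mono (by omega)
    cases k <;> rfl
  · intro u a v _
    refine ⟨rfl, ?_⟩
    by_cases ha : a = .comma
    · subst ha
      refine Exec.atom ?_ fun k => ?_
      · simp [stepAux, popInp, Memory.stk, Registers.getSym, Function.update]
      · cases k <;> simp [stepAux, popInp, Memory.stk, Registers.getSym, Function.update,
          List.range_succ]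
    · refine Exec.atom ?_ fun k => ?_
      · simp [stepAux, popInp, Memory.stk, Registers.getSym, Function.update, ha]
      · cases k <;> simp [stepAux, popInp, Memory.stk, Registers.getSym, Function.update, ha]

theorem exec_restoreInput (r : Registers) (m : Memory) (l : List Γ') :
    Exec restoreInput (r, { m with inp := [], tmp := l.reverse }.stk) (l.length * 2 + 2)
      ({ r with sym := none }, { m with inp := l.filter (· ≠ Γ'.comma), tmp := [] }.stk) := by
  have h := exec_forEach (pop := popTmp) (has := hasSym) (p := atom <|
    .branch (fun r => r.getSym = .comma) (popTmp .halt)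
      (.push .inp Registers.getSym <| popTmp .halt)) l.reverse
    (fun u v => ({ r with sym := v.head? },
      { m with inp := u.filter (· ≠ Γ'.comma), tmp := v.tail }.stk)) 1
    (a := (r, { m with inp := [], tmp := l.reverse }.stk))
    (Exec.atom rfl fun k => by cases k <;> rfl) ?_ rfl
  · rw [List.reverse_reverse, List.length_reverse] at h
    exact h
  · intro u a v _
    refine ⟨rfl, ?_⟩
    by_cases ha : a = .comma
    · refine Exec.atom ?_ fun k => ?_
      · simp [stepAux, popTmp, Memory.stk, Registers.getSym, Function.update, ha]
      · cases k <;> simp [stepAux, popTmp, Memory.stk, Registers.getSym, Function.update, ha]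
    · refine Exec.atom ?_ fun k => ?_
      · simp [stepAux, popTmp, Memory.stk, Registers.getSym, Function.update, ha]
      · cases k <;> simp [stepAux, popTmp, Memory.stk, Registers.getSym, Function.update, ha]

/-- The columns in the row `i`, with their relation to the diagonal. -/
def colMarks (n i : ℕ) : List (LineMark × Bool) :=
  (List.range n).map fun j => (lineMark n j, decide (j ≤ i))

theorem length_add_of_range_eq {n a : ℕ} {u v : List ℕ}
    (h : List.range n = u.reverse ++ a :: v) : a = u.length := by
  have h' := congrArg (fun l => l[u.length]?) h
  rw [List.getElem?_append_right (by simp)] at h'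
  simp only [List.length_reverse, Nat.sub_self, List.getElem?_cons_zero] at h'
  have := List.getElem?_eq_some_iff.1 h'
  obtain ⟨h₁, h₂⟩ := this
  simpa using h₂.symm

theorem exec_markLast (r : Registers) (m : Memory) (n : ℕ) :
    Exec markLast (r, { m with cnt := ((List.range n).map
        fun i => ((i = 0 : Bool), (i = 1 : Bool), false)).reverse, rows := [], cols := [] }.stk)
      (n * 2 + 3)
      ({ r with line := none, flag := (n = 0, false) },
        { m with cnt := [], rows := (List.range n).map (lineMark n),
                 cols := colMarks n 0 }.stk) := by
  have h := exec_forEach (pop := popCnt) (has := hasLine) (p := atom <|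
    .push .rows (fun r => (r.getLine.1, r.getLine.2.1, r.flag.1)) <|
    .push .cols (fun r => ((r.getLine.1, r.getLine.2.1, r.flag.1), r.getLine.1)) <|
    .load (fun r => { r with flag := (false, false) }) <| popCnt .halt) (List.range n).reverse
    (fun u v => ({ r with
        line := (v.map fun i => ((i = 0 : Bool), (i = 1 : Bool), false)).head?,
        flag := (u.length = 0, false) },
      { m with cnt := (v.map fun i => ((i = 0 : Bool), (i = 1 : Bool), false)).tail,
               rows := u.map (lineMark n),
               cols := u.map fun j => (lineMark n j, decide (j ≤ 0)) }.stk)) 1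
    (a := ({ r with flag := (true, false) }, { m with cnt := ((List.range n).map
        fun i => ((i = 0 : Bool), (i = 1 : Bool), false)).reverse, rows := [], cols := [] }.stk))
    (Exec.atom ?_ fun k => ?_) ?_ rfl
  · rw [List.length_reverse, List.length_range, List.reverse_reverse, List.length_range] at h
    refine (Exec.seq (Exec.atom rfl fun k => ?_) h).mono (by omega)
    cases k <;> rfl
  · simp [stepAux, popCnt, Memory.stk]
  · cases k <;> simp [stepAux, popCnt, Memory.stk, Function.update]
  · intro u a v hl
    have ha : a + 1 + u.length = n := by
      have h₁ : List.range n = v.reverse ++ a :: u := by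
        have := congrArg List.reverse hl
        simpa using this
      have h₂ := congrArg List.length h₁
      have h₃ := length_add_of_range_eq h₁
      simp at h₂
      omega
    refine ⟨rfl, Exec.atom ?_ fun k => ?_⟩
    · simp [stepAux, popCnt, Memory.stk, Function.update]
    · have h : (u.length = 0) = (a + 1 = n) := propext (by omega)
      cases k <;> simp [stepAux, popCnt, Memory.stk, Function.update, lineMark, h,
        Registers.getLine]

/-- The mark of the place `(i, j)`. -/
def placeMark (n i j : ℕ) : PlaceMark := ((lineMark n i, lineMark n j), decide (j ≤ i))

theorem exec_buildRow (r : Registers) (m : Memory) (n i : ℕ) (x : List PlaceMark) :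
    Exec buildRow ({ r with line := some (lineMark n i) },
        { m with cols := colMarks n i, colsAux := [], cells := x }.stk)
      (n * 4 + 5)
      ({ r with line := some (lineMark n i), col := none, flag := (decide (n ≤ i + 1), false) },
        { m with cols := colMarks n (i + 1), colsAux := [],
                 cells := ((List.range n).map (placeMark n i)).reverse ++ x }.stk) := by
  have h := exec_forEach (pop := popCols) (has := hasCol) (p := atom <|
      .push .cells (fun r => ((r.getLine, r.getCol.1), r.getCol.2)) <|
      .push .colsAux (fun r => (r.getCol.1, r.flag.1)) <|
      .load (fun r => { r with flag := (r.getCol.2, false) }) <| popCols .halt) (List.range n)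
    (fun u v => ({ r with
        line := some (lineMark n i)
        col := (v.map fun j => (lineMark n j, decide (j ≤ i))).head?
        flag := (decide (u.length ≤ i + 1), false) },
      { m with cols := (v.map fun j => (lineMark n j, decide (j ≤ i))).tail
               colsAux := u.map fun j => (lineMark n j, decide (j ≤ i + 1))
               cells := u.map (placeMark n i) ++ x }.stk)) 1
    (a := ({ r with line := some (lineMark n i), flag := (true, false) },
      { m with cols := colMarks n i, colsAux := [], cells := x }.stk))
    (Exec.atom ?_ fun k => ?_) ?_ rfl
  · have h' := exec_forEach (pop := popColsAux) (has := hasCol) (p := atom <|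
        .push .cols Registers.getCol <| popColsAux .halt) (colMarks n (i + 1)).reverse
      (fun u v => ({ r with
          line := some (lineMark n i)
          col := v.head?
          flag := (decide (n ≤ i + 1), false) },
        { m with cols := u
                 colsAux := v.tail
                 cells := ((List.range n).map (placeMark n i)).reverse ++ x }.stk)) 1
      (a := ({ r with
          line := some (lineMark n i)
          col := none
          flag := (decide (n ≤ i + 1), false) },
        { m with cols := []
                 colsAux := (colMarks n (i + 1)).reverse
                 cells := ((List.range n).map (placeMark n i)).reverse ++ x }.stk))
      (Exec.atom rfl fun k => by cases k <;> rfl) ?_ rfl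
    · rw [List.reverse_reverse, List.length_reverse] at h'
      have hl : (colMarks n (i + 1)).length = n := by simp [colMarks]
      rw [hl] at h'
      rw [List.length_reverse, List.length_range, List.map_reverse, List.map_reverse] at h
      refine (Exec.seq (Exec.seq (Exec.atom rfl fun k => ?_) h) h').mono ?_
      · cases k <;> rfl
      · omega
    · intro u a v _
      exact ⟨rfl, Exec.atom rfl fun k => by cases k <;> rfl⟩
  · simp [stepAux, popCols, Memory.stk, colMarks]
  · cases k <;> simp [stepAux, popCols, Memory.stk, Function.update, colMarks]
  · intro u a v hl
    have ha := length_add_of_range_eq hl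
    refine ⟨rfl, Exec.atom ?_ fun k => ?_⟩
    · simp [stepAux, popCols, Memory.stk, Function.update, Registers.getCol, ha]
    · cases k <;> simp [stepAux, popCols, Memory.stk, Function.update, Registers.getLine,
        Registers.getCol, placeMark, ha]

theorem exec_buildCells (r : Registers) (m : Memory) (n : ℕ) :
    ∃ r' : Registers, r'.sym = r.sym ∧ Exec buildCells (r,
        { m with rows := (List.range n).map (lineMark n), cols := colMarks n 0, colsAux := [],
                 cells := [] }.stk)
      (n * (n * 4 + 9) + 4)
      (r', { m with
                 rows := [], cols := [], colsAux := [],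
                 cells := ((List.range n).flatMap fun i =>
                   (List.range n).map (placeMark n i)).reverse }.stk) := by
  have h := exec_forEach (pop := popRows) (has := hasLine)
    (p := seq buildRow <| atom <| popRows .halt) (List.range n)
    (fun u v => ({ r with
        line := (v.map (lineMark n)).head?
        col := cond u.isEmpty r.col none
        flag := cond u.isEmpty r.flag (decide (n ≤ u.length), false) },
      { m with rows := (v.map (lineMark n)).tail
               cols := colMarks n u.length
               colsAux := []
               cells := u.flatMap fun i => ((List.range n).map (placeMark n i)).reverse }.stk))
    (n * 4 + 6)
    (a := (r, { m with rows := (List.range n).map (lineMark n), cols := colMarks n 0,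
                       colsAux := [], cells := [] }.stk))
    (Exec.atom rfl fun k => by cases k <;> rfl) ?_ rfl
  · have h' := fun r => exec_forEach (pop := popCols) (has := hasCol)
      (p := atom <| popCols .halt) (colMarks n n)
      (fun u v => ({ r with col := v.head? },
        { m with
                 rows := [], cols := v.tail, colsAux := [],
                 cells := ((List.range n).flatMap fun i =>
                   (List.range n).map (placeMark n i)).reverse }.stk)) 1
      (a := (r, { m with
                 rows := [], cols := colMarks n n, colsAux := [],
                 cells := ((List.range n).flatMap fun i =>
                   (List.range n).map (placeMark n i)).reverse }.stk))
      (Exec.atom rfl fun k => by cases k <;> rfl)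
      (fun u a v _ => ⟨rfl, Exec.atom rfl fun k => by cases k <;> rfl⟩) rfl
    have hl : (colMarks n n).length = n := by simp [colMarks]
    simp only [hl] at h'
    have e : (List.range n).reverse.flatMap
          (fun i => ((List.range n).map (placeMark n i)).reverse) =
        ((List.range n).flatMap fun i => (List.range n).map (placeMark n i)).reverse := by
      rw [List.reverse_flatMap]; rfl
    rw [List.length_reverse, List.length_range, e] at h
    refine ⟨_, ?_, (Exec.seq h (h' _)).mono (by ring_nf; omega)⟩
    rfl
  · intro u a v hl
    obtain rfl := length_add_of_range_eq hl
    refine ⟨rfl, Exec.mono (t := n * 4 + 5 + 1) (Exec.seq (exec_buildRow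
      { r with
        col := cond u.isEmpty r.col none
        flag := cond u.isEmpty r.flag (decide (n ≤ u.length), false) }
      { m with rows := v.map (lineMark n) } n u.length _) (Exec.atom ?_ fun k => ?_)) (by omega)⟩
    · rfl
    · cases k <;> rfl

/-! ### Writing the rows -/

/-- The entries of the row of a switch in the columns of the relative place `d`. -/
def switchWord (one : List Bool) (a : Option (List Bool)) (c d : PlaceMark) : List Γ' :=
  encodeEntry (if isHere d then a else none) ++ edgeWord one (switchToWire c d)

/-- The entries of the row of a wire in the columns of the relative place `d`. -/
def wireWord (one : List Bool) (c d : PlaceMark) : List Γ' :=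
  edgeWord one (wireToSwitch c d) ++ edgeWord one (wireToWire c d)

theorem update_stk_acc (m : Memory) (x : List Γ') :
    Function.update m.stk .acc x = { m with acc := x }.stk := by
  funext k; cases k <;> rfl

theorem stepAux_pushWord (w : List Γ') (q : Block) (r : Registers) (m : Memory) :
    stepAux (pushWord w q) r m.stk = stepAux q r { m with acc := w.reverse ++ m.acc }.stk := by
  induction w generalizing m with
  | nil => rfl
  | cons s w ih =>
    change stepAux (pushWord w q) r (Function.update m.stk .acc (s :: m.acc)) = _
    rw [update_stk_acc, ih]
    simp

theorem stepAux_emitEdge (one : List Bool) (b : PlaceMark → PlaceMark → Bool) (q : Block)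
    (r : Registers) (m : Memory) :
    stepAux (emitEdge one b q) r m.stk = stepAux q r
      { m with acc := (edgeWord one (b r.getPlace r.getMark)).reverse ++ m.acc }.stk := by
  rw [emitEdge, stepAux, stepAux_pushWord, stepAux_pushWord]
  cases b r.getPlace r.getMark <;> rfl

theorem exec_copyBits (r : Registers) (m : Memory) (w : List Bool) (s : Γ') (rest x : List Γ')
    (hs : isCopying { r with sym := some s } = true) :
    Exec (loop isCopying <| atom <| popInp <| .push .acc Registers.getSym .halt)
      ({ r with sym := some s }, { m with inp := w.map Γ'.bit ++ Γ'.ket :: rest, acc := x }.stk)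
      (w.length * 2 + 3)
      ({ r with sym := some .ket },
        { m with inp := rest, acc := (w.map Γ'.bit ++ [Γ'.ket]).reverse ++ x }.stk) := by
  induction w generalizing s x with
  | nil =>
    refine Exec.loop_true (t := 1) (u := 1)
      (c := ({ r with sym := some .ket }, { m with inp := rest, acc := Γ'.ket :: x }.stk)) hs ?_ ?_
    · exact Exec.atom rfl fun k => by cases k <;> rfl
    · exact Exec.loop_false rfl
  | cons b w ih =>
    refine (Exec.loop_true (t := 1) (u := w.length * 2 + 3) (c := ({ r with sym := some (.bit b) },
      { m with inp := w.map Γ'.bit ++ Γ'.ket :: rest, acc := Γ'.bit b :: x }.stk)) hs ?_ ?_).mono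
      (by rw [List.length_cons]; omega)
    · exact Exec.atom rfl fun k => by cases k <;> rfl
    · simpa using ih (.bit b) (Γ'.bit b :: x) rfl

theorem exec_copyEntry (r : Registers) (m : Memory) (a : Option (List Bool)) (rest x : List Γ')
    (c d : PlaceMark) (b : Bool) (hb : isHere d = b) :
    ∃ s : Option Γ', Exec copyEntry
      ({ r with mark := some d, place := some c },
        { m with inp := (if b then encodeEntry a else []) ++ rest, acc := x }.stk)
      ((encodeEntry a).length * 2 + 1)
      ({ r with sym := s, mark := some d, place := some c },
        { m with inp := rest, acc := (encodeEntry (if b then a else none)).reverse ++ x }.stk) := by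
  unfold copyEntry
  cases b with
  | false =>
    refine ⟨none, (Exec.seq (t := 1) (u := 1) (b := ({ r with
      sym := none, mark := some d, place := some c },
      { m with inp := rest, acc := Γ'.blank :: x }.stk)) (Exec.atom ?_ fun k => ?_)
      (Exec.loop_false rfl)).mono ?_⟩
    · simp [stepAux, Registers.getMark, hb]
    · cases k <;> simp [stepAux, Registers.getMark, hb, Memory.stk, Function.update]
    · cases a <;> simp [encodeEntry]; omega
  | true =>
    cases a with
    | none =>
      refine ⟨some .blank, (Exec.seq (t := 1) (u := 1) (b := ({ r with
        sym := some .blank, mark := some d, place := some c },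
        { m with inp := rest, acc := Γ'.blank :: x }.stk)) (Exec.atom ?_ fun k => ?_)
        (Exec.loop_false rfl)).mono ?_⟩
      · simp [stepAux, Registers.getMark, hb, popInp, Memory.stk, encodeEntry]
      · cases k <;> simp [stepAux, Registers.getMark, hb, Memory.stk, Function.update, popInp,
          encodeEntry, Registers.getSym]
      · simp [encodeEntry]
    | some w =>
      have h := exec_copyBits { r with mark := some d, place := some c } m w .bra rest
        (Γ'.bra :: x) rfl
      refine ⟨some .ket, (Exec.seq (t := 1) (u := w.length * 2 + 3) (b := ({ r with
        sym := some .bra, mark := some d, place := some c },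
        { m with inp := w.map Γ'.bit ++ Γ'.ket :: rest, acc := Γ'.bra :: x }.stk))
        (Exec.atom ?_ fun k => ?_) ?_).mono ?_⟩
      · simp [stepAux, Registers.getMark, hb, popInp, Memory.stk, encodeEntry]
      · cases k <;> simp [stepAux, Registers.getMark, hb, Memory.stk, Function.update, popInp,
          encodeEntry, Registers.getSym]
      · simpa [encodeEntry] using h
      · simp [encodeEntry]
        omega

theorem exec_switchRow (one : List Bool) (r : Registers) (m : Memory) (a : Option (List Bool))
    (rest x : List Γ') (c : PlaceMark) (l : List PlaceMark) :
    Exec (switchRow one)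
      ({ r with sym := none, place := some c },
        { m with inp := (l.filter isHere).flatMap (fun _ => encodeEntry a) ++ rest, marks := l,
                 marksAux := [], acc := x }.stk)
      (l.length * ((encodeEntry a).length * 2 + 3) + 3)
      ({ r with sym := none, mark := none, place := some c },
        { m with inp := rest, marks := [], marksAux := l.reverse,
                 acc := Γ'.comma :: (l.flatMap (switchWord one a c)).reverse ++ x }.stk) := by
  have h := exec_forEach (pop := popMarks) (has := hasMark) (p :=
    seq copyEntry <|
    atom <| emitEdge one switchToWire <| .load (fun r => { r with sym := none }) <|
      .push .marksAux Registers.getMark <| popMarks .halt) l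
    (fun u v => ({ r with sym := none, mark := v.head?, place := some c },
      { m with inp := (v.filter isHere).flatMap (fun _ => encodeEntry a) ++ rest, marks := v.tail,
               marksAux := u,
               acc := u.flatMap (fun d => (switchWord one a c d).reverse) ++ x }.stk))
    ((encodeEntry a).length * 2 + 2)
    (a := ({ r with sym := none, place := some c },
        { m with inp := (l.filter isHere).flatMap (fun _ => encodeEntry a) ++ rest, marks := l,
                 marksAux := [], acc := x }.stk))
    (Exec.atom rfl fun k => by cases k <;> rfl) ?_ rfl
  · have e : l.reverse.flatMap (fun d => (switchWord one a c d).reverse) =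
        (l.flatMap (switchWord one a c)).reverse := by
      rw [List.reverse_flatMap]; rfl
    rw [e] at h
    refine (Exec.seq h (Exec.atom rfl fun k => ?_)).mono le_rfl
    cases k <;> rfl
  · intro u d v _
    refine ⟨rfl, ?_⟩
    obtain ⟨s, hs⟩ := exec_copyEntry { r with sym := none }
      { m with marks := v, marksAux := u } a
      ((v.filter isHere).flatMap (fun _ => encodeEntry a) ++ rest)
      (u.flatMap (fun d => (switchWord one a c d).reverse) ++ x) c d _ rfl
    have e : ((d :: v).filter isHere).flatMap (fun _ => encodeEntry a) ++ rest =
        (if isHere d then encodeEntry a else []) ++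
          ((v.filter isHere).flatMap (fun _ => encodeEntry a) ++ rest) := by
      cases hd : isHere d <;> simp [hd]
    rw [e]
    refine Exec.mono (t := (encodeEntry a).length * 2 + 1 + 1)
      (Exec.seq hs (Exec.atom ?_ fun k => ?_)) le_rfl
    · rw [stepAux_emitEdge]
      rfl
    · rw [stepAux_emitEdge]
      cases k <;> simp [stepAux, popMarks, Memory.stk, Function.update, Registers.getMark,
        Registers.getPlace, switchWord]

theorem exec_wireRow (one : List Bool) (r : Registers) (m : Memory)
    (x : List Γ') (c : PlaceMark) (l : List PlaceMark) :
    Exec (wireRow one)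
      ({ r with place := some c }, { m with marks := l, marksAux := [], acc := x }.stk)
      (l.length * 2 + 3)
      ({ r with mark := none, place := some c },
        { m with marks := [], marksAux := l.reverse,
                 acc := Γ'.comma :: (l.flatMap (wireWord one c)).reverse ++ x }.stk) := by
  have h := exec_forEach (pop := popMarks) (has := hasMark) (p :=
    atom <| emitEdge one wireToSwitch <| emitEdge one wireToWire <|
      .push .marksAux Registers.getMark <| popMarks .halt) l
    (fun u v => ({ r with mark := v.head?, place := some c },
      { m with marks := v.tail, marksAux := u,
               acc := u.flatMap (fun d => (wireWord one c d).reverse) ++ x }.stk)) 1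
    (a := ({ r with place := some c }, { m with marks := l, marksAux := [], acc := x }.stk))
    (Exec.atom rfl fun k => by cases k <;> rfl) ?_ rfl
  · have e : l.reverse.flatMap (fun d => (wireWord one c d).reverse) =
        (l.flatMap (wireWord one c)).reverse := by
      rw [List.reverse_flatMap]; rfl
    rw [e] at h
    refine (Exec.seq h (Exec.atom rfl fun k => ?_)).mono le_rfl
    cases k <;> rfl
  · intro u d v _
    refine ⟨rfl, Exec.atom ?_ fun k => ?_⟩
    · rw [stepAux_emitEdge, stepAux_emitEdge]
      rfl
    · rw [stepAux_emitEdge, stepAux_emitEdge]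
      cases k <;> simp [stepAux, popMarks, Memory.stk, Function.update, Registers.getMark,
        Registers.getPlace, wireWord]

/-- The two rows of a place with the mark `c`, if `l` are the marks of the relative places and `a`
is the weight of the loop. -/
def placeWord (one : List Bool) (a : Option (List Bool)) (c : PlaceMark) (l : List PlaceMark) :
    List Γ' :=
  l.flatMap (switchWord one a c) ++ Γ'.comma :: (l.flatMap (wireWord one c) ++ [Γ'.comma])

/-- The effect of `writeRows` on lists of marks that rotate from place to place and in which exactly
one mark is that of the relative place `0`: the other entries in the columns of switches need no
input. -/
theorem exec_writeRows (one : List Bool) (r : Registers) (m : Memory) (N B : ℕ)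
    (place : ℕ → PlaceMark) (marks : ℕ → List PlaceMark) (weight : ℕ → Option (List Bool))
    (hrot : ∀ c < N, ∃ l d, marks c = l ++ [d] ∧ marks (c + 1) = d :: l)
    (hhere : ∀ c < N, ((marks c).filter isHere).length = 1)
    (hlen : ∀ c, (marks c).length = N)
    (hB : ∀ c < N, (encodeEntry (weight c)).length ≤ B) :
    Exec (writeRows one)
      ({ r with sym := none, mark := none },
        { m with inp := (List.range N).flatMap fun c => encodeEntry (weight c),
                 marks := marks 0, marksAux := [], acc := [],
                 todo := (List.range N).map place }.stk)
      (N * (N * (B * 2 + 10) + 14) + 2)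
      ({ r with sym := none, mark := none, place := none },
        { m with inp := [], marks := marks N, marksAux := [], todo := [],
                 acc := ((List.range N).flatMap
                   fun c => placeWord one (weight c) (place c) (marks c)).reverse }.stk) := by
  have h := exec_forEach (pop := popTodo) (has := hasPlace) (p :=
    seq (switchRow one) <| seq restoreMarks <| seq (wireRow one) <| seq rotateMarks <|
    atom <| popTodo .halt) (List.range N)
    (fun u v => ({ r with sym := none, mark := none, place := (v.map place).head? },
      { m with inp := v.flatMap fun c => encodeEntry (weight c),
               marks := marks u.length, marksAux := [],
               acc := u.flatMap fun c => (placeWord one (weight c) (place c) (marks c)).reverse,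
               todo := (v.map place).tail }.stk))
    (N * (B * 2 + 10) + 13)
    (a := ({ r with sym := none, mark := none },
        { m with inp := (List.range N).flatMap fun c => encodeEntry (weight c),
                 marks := marks 0, marksAux := [], acc := [],
                 todo := (List.range N).map place }.stk))
    (Exec.atom rfl fun k => by cases k <;> rfl) ?_ rfl
  · have e : (List.range N).reverse.flatMap
          (fun c => (placeWord one (weight c) (place c) (marks c)).reverse) =
        ((List.range N).flatMap fun c => placeWord one (weight c) (place c) (marks c)).reverse := by
      rw [List.reverse_flatMap]; rfl
    rw [e, List.length_reverse, List.length_range] at h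
    exact h
  · intro u c v hl
    have hc : c < N := List.mem_range.1 (by rw [hl]; simp)
    obtain rfl := length_add_of_range_eq hl
    obtain ⟨l, d, h₁, h₂⟩ := hrot _ hc
    refine ⟨rfl, ?_⟩
    have e : ((marks u.length).filter isHere).flatMap (fun _ => encodeEntry (weight u.length)) =
        encodeEntry (weight u.length) := by
      obtain ⟨z, hz⟩ := List.length_eq_one_iff.1 (hhere _ hc)
      simp [hz]
    set x := u.flatMap fun c => (placeWord one (weight c) (place c) (marks c)).reverse with hx
    have hs := exec_switchRow one { r with mark := none } { m with todo := v.map place }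
      (weight u.length) (v.flatMap fun c => encodeEntry (weight c)) x (place u.length)
      (marks u.length)
    rw [e] at hs
    have hr := exec_restoreMarks
      { r with sym := none, mark := none, place := some (place u.length) }
      { m with
        inp := v.flatMap fun c => encodeEntry (weight c)
        acc := Γ'.comma ::
          ((marks u.length).flatMap
            (switchWord one (weight u.length) (place u.length))).reverse ++ x
        todo := v.map place } (marks u.length).reverse []
    rw [List.reverse_reverse, List.append_nil] at hr
    have hw := exec_wireRow one { r with sym := none, mark := none }
      { m with inp := v.flatMap fun c => encodeEntry (weight c), todo := v.map place }
      (Γ'.comma ::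
        ((marks u.length).flatMap (switchWord one (weight u.length) (place u.length))).reverse ++ x)
      (place u.length) (marks u.length)
    have ho := exec_rotateMarks { r with sym := none, mark := none, place := some (place u.length) }
      { m with
        inp := v.flatMap fun c => encodeEntry (weight c)
        acc := Γ'.comma :: ((marks u.length).flatMap (wireWord one (place u.length))).reverse ++
          (Γ'.comma ::
            ((marks u.length).flatMap (switchWord one (weight u.length) (place u.length))).reverse
              ++ x)
        todo := v.map place } d l.reverse
    have hrev : d :: l.reverse = (marks u.length).reverse := by rw [h₁]; simp
    rw [hrev, List.reverse_reverse, ← h₂] at ho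
    have hlen' : (l.length : ℕ) + 1 = N := by
      rw [← hlen u.length, h₁]; simp
    refine Exec.mono (Exec.seq hs <| Exec.seq hr <| Exec.seq hw <| Exec.seq ho <|
      Exec.atom (q := popTodo .halt) rfl fun k => ?_) ?_
    · cases k <;> simp [stepAux, popTodo, Memory.stk, Function.update, placeWord, hx]
    · rw [List.length_reverse, List.length_reverse, hlen]
      have := Nat.mul_le_mul_left u.length (hB _ hc)
      have h₃ : N * ((encodeEntry (weight u.length)).length * 2 + 3) ≤ N * (B * 2 + 3) :=
        Nat.mul_le_mul_left _ (by have := hB _ hc; omega)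
      have h₄ : N * (B * 2 + 10) = N * (B * 2 + 3) + N * 7 := by ring
      omega

theorem exec_finish (r : Registers) (l : List PlaceMark) (x : List Γ') :
    Exec finish (r, { marks := l, acc := x : Memory }.stk) (l.length * 2 + x.length * 2 + 5)
      (Registers.initial, { out := x.reverse : Memory }.stk) := by
  have h := exec_forEach (pop := popMarks) (has := hasMark)
    (p := atom <| popMarks .halt) l
    (fun _ v => ({ r with mark := v.head? }, { marks := v.tail, acc := x : Memory }.stk)) 1
    (a := (r, { marks := l, acc := x : Memory }.stk))
    (Exec.atom rfl fun k => by cases k <;> rfl)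
    (fun u a v _ => ⟨rfl, Exec.atom rfl fun k => by cases k <;> rfl⟩) rfl
  have h' := exec_forEach (pop := popAcc) (has := hasSym)
    (p := atom <| .push .out Registers.getSym <| popAcc .halt) x
    (fun u v => ({ r with mark := none, sym := v.head? },
      { acc := v.tail, out := u : Memory }.stk)) 1
    (a := ({ r with mark := none }, { acc := x : Memory }.stk))
    (Exec.atom rfl fun k => by cases k <;> rfl)
    (fun u a v _ => ⟨rfl, Exec.atom rfl fun k => by cases k <;> rfl⟩) rfl
  exact (Exec.seq h <| Exec.seq h' <| Exec.atom rfl fun k => rfl).mono (by omega)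

/-! ### The output of the program -/

/-- The mark of the place with the number `k`. -/
def placeMarkAt (n k : ℕ) : PlaceMark := placeMark n (k / n) (k % n)

/-- The marks of all places relative to the place with the number `c`, cyclically. -/
def relativeMarks (n c : ℕ) : List PlaceMark :=
  (List.range (n * n)).map fun x => placeMarkAt n ((x + (n * n - c)) % (n * n))

theorem map_range_mul {α : Type*} (m n : ℕ) (f : ℕ → α) :
    (List.range (m * n)).map f =
      (List.range m).flatMap fun i => (List.range n).map fun j => f (n * i + j) := by
  induction m with
  | zero => simp
  | succ m ih =>
    rw [Nat.succ_mul, List.range_add, List.map_append, ih, List.range_succ, List.flatMap_append]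
    simp [Function.comp_def, mul_comm]

theorem map_placeMarkAt_range (n : ℕ) : (List.range (n * n)).map (placeMarkAt n) =
    (List.range n).flatMap fun i => (List.range n).map (placeMark n i) := by
  rw [map_range_mul]
  refine List.flatMap_congr fun i hi => List.map_congr_left fun j hj => ?_
  rw [List.mem_range] at hj
  have hn : 0 < n := by omega
  rw [placeMarkAt, Nat.mul_add_div hn, Nat.mul_add_mod, Nat.div_eq_of_lt hj, Nat.mod_eq_of_lt hj,
    add_zero]

theorem relativeMarks_zero (n : ℕ) :
    relativeMarks n 0 = (List.range (n * n)).map (placeMarkAt n) := by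
  refine List.map_congr_left fun x hx => ?_
  rw [List.mem_range] at hx
  rw [Nat.sub_zero, Nat.add_mod_right, Nat.mod_eq_of_lt hx]

theorem length_relativeMarks (n c : ℕ) : (relativeMarks n c).length = n * n := by
  simp [relativeMarks]

theorem relativeMarks_rotate {n c : ℕ} (hc : c < n * n) :
    ∃ l d, relativeMarks n c = l ++ [d] ∧ relativeMarks n (c + 1) = d :: l := by
  obtain ⟨N, hN⟩ : ∃ N, n * n = N + 1 := ⟨n * n - 1, by omega⟩
  refine ⟨(List.range N).map fun x => placeMarkAt n ((x + (n * n - c)) % (n * n)),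
    placeMarkAt n ((N + (n * n - c)) % (n * n)), ?_, ?_⟩
  · rw [relativeMarks]
    conv_lhs => rw [show List.range (n * n) = List.range N ++ [N] by rw [hN, List.range_succ]]
    simp
  · rw [relativeMarks]
    conv_lhs => rw [show List.range (n * n) = 0 :: (List.range N).map Nat.succ by
      rw [hN, List.range_succ_eq_map]]
    rw [List.map_cons, List.map_map]
    congr 1
    · congr 1
      have h : N + (n * n - c) = 0 + (n * n - (c + 1)) + n * n := by omega
      rw [h, Nat.add_mod_right]
    · refine List.map_congr_left fun x _ => ?_
      simp only [Function.comp_apply]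
      congr 2
      omega

theorem isHere_placeMarkAt {n k : ℕ} : isHere (placeMarkAt n k) = true ↔ k / n = 0 ∧ k % n = 0 := by
  simp [isHere, placeMarkAt, placeMark, lineMark]

theorem relative_eq {N c x : ℕ} (hc : c < N) (hx : x < N) :
    (c ≤ x ∧ (x + (N - c)) % N = x - c) ∨ (x < c ∧ (x + (N - c)) % N = x + N - c) := by
  rcases le_or_gt c x with h | h
  · refine Or.inl ⟨h, ?_⟩
    rw [show x + (N - c) = x - c + N by omega, Nat.add_mod_right, Nat.mod_eq_of_lt (by omega)]
  · refine Or.inr ⟨h, ?_⟩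
    rw [Nat.mod_eq_of_lt (by omega)]
    omega

theorem div_mod_iff {n k a b : ℕ} (hb : b < n) : (k / n = a ∧ k % n = b) ↔ k = n * a + b := by
  constructor
  · rintro ⟨rfl, rfl⟩
    exact (Nat.div_add_mod k n).symm
  · rintro rfl
    have hn : 0 < n := by omega
    rw [Nat.mul_add_div hn, Nat.mul_add_mod, Nat.div_eq_of_lt hb, Nat.mod_eq_of_lt hb]
    simp

theorem length_filter_isHere {n c : ℕ} (hc : c < n * n) :
    ((relativeMarks n c).filter isHere).length = 1 := by
  have hn : 0 < n := by
    rcases Nat.eq_zero_or_pos n with rfl | h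
    · simp at hc
    · exact h
  rw [relativeMarks, List.filter_map, List.length_map, ← List.countP_eq_length_filter]
  have : List.countP (isHere ∘ fun x => placeMarkAt n ((x + (n * n - c)) % (n * n)))
      (List.range (n * n)) = List.count c (List.range (n * n)) := by
    rw [List.count]
    refine List.countP_congr fun x hx => ?_
    rw [List.mem_range] at hx
    rw [Function.comp_apply, isHere_placeMarkAt, div_mod_iff hn, beq_iff_eq]
    rcases relative_eq hc hx with h | h <;> omega
  rw [this]
  exact List.count_eq_one_of_mem List.nodup_range (List.mem_range.2 hc)

section

variable {n : ℕ} (p q : Fin n × Fin n)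

/-- The mark of the place `q` relative to the place `p`. -/
def relativeMark : PlaceMark :=
  placeMarkAt n (((finProdFinEquiv q : Fin (n * n)).val +
    (n * n - (finProdFinEquiv p : Fin (n * n)).val)) % (n * n))

theorem placeMarkAt_finProdFinEquiv :
    placeMarkAt n (finProdFinEquiv p : Fin (n * n)) = placeMark n p.1 p.2 := by
  have hn : 0 < n := p.1.pos
  have h := (div_mod_iff (k := ((finProdFinEquiv p : Fin (n * n)) : ℕ)) (a := p.1.val) p.2.2).2
    (by simp [finProdFinEquiv, add_comm])
  rw [placeMarkAt, h.1, h.2]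

theorem isHere_relativeMark : isHere (relativeMark p q) = true ↔ q = p := by
  have hn : 0 < n := p.1.pos
  rw [relativeMark, isHere_placeMarkAt, div_mod_iff hn, ← finProdFinEquiv.injective.eq_iff,
    Fin.ext_iff]
  rcases relative_eq (finProdFinEquiv p).2 (finProdFinEquiv q).2 with h | h <;> omega

/-- The relative position of `q` and `p` in terms of the numbers `x` and `y` of the two places. -/
theorem relativeMark_cases : ∃ k x y : ℕ, relativeMark p q = placeMarkAt n k ∧ k < n * n ∧
    x = n * p.1 + p.2 ∧ x < n * n ∧ y < n * n ∧
    (∀ a b, b < n → (y = n * a + b ↔ q.1.val = a ∧ q.2.val = b)) ∧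
    ((x ≤ y ∧ k = y - x) ∨ (y < x ∧ k = y + n * n - x)) := by
  have hx : ((finProdFinEquiv p : Fin (n * n)) : ℕ) = n * p.1 + p.2 := by
    simp [finProdFinEquiv, add_comm]
  have hy : ((finProdFinEquiv q : Fin (n * n)) : ℕ) = n * q.1 + q.2 := by
    simp [finProdFinEquiv, add_comm]
  refine ⟨_, _, _, rfl, Nat.mod_lt _ (Nat.mul_pos p.1.pos p.1.pos), hx,
    (finProdFinEquiv p).2, (finProdFinEquiv q).2, fun a b hb => ?_, ?_⟩
  · have := (div_mod_iff (a := q.1.val) q.2.2).2 rfl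
    rw [hy, ← div_mod_iff hb, this.1, this.2]
  · exact relative_eq (finProdFinEquiv p).2 (finProdFinEquiv q).2

theorem isAbove_relativeMark (hp : 0 < p.1.val) :
    isAbove (relativeMark p q) = true ↔ q.1.val + 1 = p.1.val ∧ q.2.val = p.2.val := by
  obtain ⟨k, x, y, hd, hk, hx, hxN, hyN, hy, hxy⟩ := relativeMark_cases p q
  have hn : 0 < n := p.1.pos
  obtain ⟨m, hm⟩ : ∃ m, p.1.val = m + 1 := ⟨p.1.val - 1, by omega⟩
  obtain ⟨l, hl⟩ : ∃ l, n = l + 1 := ⟨n - 1, by omega⟩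
  have h : isAbove (relativeMark p q) = true ↔ k = n * l + 0 := by
    rw [← div_mod_iff hn, hd]
    simp only [isAbove, placeMarkAt, placeMark, lineMark, Bool.and_eq_true, decide_eq_true_eq]
    omega
  have hN : n * n = n * l + n := by
    conv_lhs => rw [hl, Nat.mul_succ, ← hl]
  have h' := hy m p.2 p.2.2
  rw [hm, Nat.mul_add] at hx
  rw [h, hm]
  refine Iff.trans ?_ (h'.trans ?_) <;> omega

theorem isBelow_relativeMark (hp : p.1.val + 1 < n) :
    isBelow (relativeMark p q) = true ↔ q.1.val = p.1.val + 1 ∧ q.2.val = p.2.val := by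
  obtain ⟨k, x, y, hd, hk, hx, hxN, hyN, hy, hxy⟩ := relativeMark_cases p q
  have hn : 0 < n := p.1.pos
  have h : isBelow (relativeMark p q) = true ↔ k = n * 1 + 0 := by
    rw [← div_mod_iff hn, hd]
    simp only [isBelow, placeMarkAt, placeMark, lineMark, Bool.and_eq_true, decide_eq_true_eq]
  have hN : n * p.1.val + n + n ≤ n * n := by
    have := Nat.mul_le_mul_left n (show p.1.val + 2 ≤ n by omega)
    rw [Nat.mul_add] at this
    omega
  have h' := hy (p.1.val + 1) p.2 p.2.2
  have hp2 := p.2.2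
  rw [Nat.mul_add] at h'
  rw [h, ← h']
  omega

theorem isBelowRight_relativeMark (hp : p.1.val + 1 < n) (hp' : p.2.val + 1 < n) :
    isBelowRight (relativeMark p q) = true ↔
      q.1.val = p.1.val + 1 ∧ q.2.val = p.2.val + 1 := by
  obtain ⟨k, x, y, hd, hk, hx, hxN, hyN, hy, hxy⟩ := relativeMark_cases p q
  have h : isBelowRight (relativeMark p q) = true ↔ k = n * 1 + 1 := by
    rw [← div_mod_iff (by omega), hd]
    simp only [isBelowRight, placeMarkAt, placeMark, lineMark, Bool.and_eq_true, decide_eq_true_eq]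
  have hN : n * p.1.val + n + n ≤ n * n := by
    have := Nat.mul_le_mul_left n (show p.1.val + 2 ≤ n by omega)
    rw [Nat.mul_add] at this
    omega
  have h' := hy (p.1.val + 1) (p.2.val + 1) hp'
  rw [Nat.mul_add] at h'
  rw [h, ← h']
  omega

theorem isLeft_relativeMark (hp : 0 < p.2.val) :
    isLeft (relativeMark p q) = true ↔ q.1 = p.1 ∧ q.2.val + 1 = p.2.val := by
  obtain ⟨k, x, y, hd, hk, hx, hxN, hyN, hy, hxy⟩ := relativeMark_cases p q
  obtain ⟨l, hl⟩ : ∃ l, n = l + 1 := ⟨n - 1, by omega⟩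
  have hp2 := p.2.2
  have h : isLeft (relativeMark p q) = true ↔ k = n * l + l := by
    rw [← div_mod_iff (by omega), hd]
    simp only [isLeft, placeMarkAt, placeMark, lineMark, Bool.and_eq_true, decide_eq_true_eq]
    omega
  have hN : n * n = n * l + n := by
    conv_lhs => rw [hl, Nat.mul_succ, ← hl]
  have h' := hy p.1 (p.2.val - 1) (by omega)
  rw [h, Fin.ext_iff]
  refine Iff.trans ?_ (h'.trans ?_) <;> omega

theorem switchToWire_iff : switchToWire (placeMark n p.1 p.2) (relativeMark p q) = true ↔
    CrossbarEdge (p, 0) (q, 1) := by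
  have hlast : inLastRow (placeMark n p.1 p.2) = true ↔ p.1.val + 1 = n := by
    simp [inLastRow, placeMark, lineMark]
  have hfirst : inFirstRow (placeMark n p.1 p.2) = true ↔ p.1.val = 0 := by
    simp [inFirstRow, placeMark, lineMark]
  have hp := p.1.2
  rw [switchToWire, Bool.or_eq_true, Bool.and_eq_true, Bool.and_eq_true, Bool.not_eq_true',
    Bool.not_eq_true', ← Bool.not_eq_true, ← Bool.not_eq_true, hlast, hfirst, isHere_relativeMark]
  simp only [CrossbarEdge, zero_ne_one, false_and, or_false, true_and, Prod.ext_iff, Fin.ext_iff]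
  rcases Nat.eq_zero_or_pos p.1.val with h | h
  · omega
  · rw [isAbove_relativeMark p q h]
    omega

theorem wireToSwitch_iff : wireToSwitch (placeMark n p.1 p.2) (relativeMark p q) = true ↔
    CrossbarEdge (p, 1) (q, 0) := by
  have hlast : inLastRow (placeMark n p.1 p.2) = true ↔ p.1.val + 1 = n := by
    simp [inLastRow, placeMark, lineMark]
  have hdiag : notAboveDiagonal (placeMark n p.1 p.2) = decide (p.2.val ≤ p.1.val) := rfl
  have hp := p.1.2
  have hp' := p.2.2
  rw [wireToSwitch, Bool.and_eq_true, Bool.not_eq_true', ← Bool.not_eq_true, hlast, hdiag]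
  simp only [CrossbarEdge, one_ne_zero, zero_ne_one, false_and, false_or, true_and, Prod.ext_iff,
    Fin.ext_iff, and_false, Fin.le_def, Fin.lt_def]
  by_cases hlt : p.1.val + 1 = n
  · omega
  rcases le_or_gt p.2.val p.1.val with h | h
  · rw [decide_eq_true h, cond_true, Bool.or_eq_true, isBelow_relativeMark p q (by omega),
      isBelowRight_relativeMark p q (by omega) (by omega)]
    omega
  · rw [decide_eq_false (by omega), cond_false, Bool.or_eq_true, isHere_relativeMark,
      isLeft_relativeMark p q (by omega)]
    simp only [Prod.ext_iff, Fin.ext_iff]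
    omega

theorem wireToWire_iff : wireToWire (placeMark n p.1 p.2) (relativeMark p q) = true ↔
    CrossbarEdge (p, 1) (q, 1) := by
  have hlast : inLastRow (placeMark n p.1 p.2) = true ↔ p.1.val + 1 = n := by
    simp [inLastRow, placeMark, lineMark]
  rw [wireToWire, Bool.and_eq_true, isHere_relativeMark, hlast]
  simp only [CrossbarEdge, one_ne_zero, false_and, false_or, true_and, Prod.ext_iff,
    and_true, or_false]

end

/-- The code of the weight of the edge with the number `c`, row by row. -/
def weightAt (G : CodedDigraph) (c : ℕ) : Option (List Bool) :=
  if h : c < G.n * G.n then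
    G.entry (finProdFinEquiv.symm (⟨c, h⟩ : Fin (G.n * G.n))).1
      (finProdFinEquiv.symm (⟨c, h⟩ : Fin (G.n * G.n))).2
  else none

theorem weightAt_finProdFinEquiv (G : CodedDigraph) (p : Fin G.n × Fin G.n) :
    weightAt G (finProdFinEquiv p : Fin (G.n * G.n)) = G.entry p.1 p.2 := by
  rw [weightAt, dif_pos (finProdFinEquiv p).2, Fin.eta, Equiv.symm_apply_apply]

theorem flatMap_range_eq {α : Type*} (N : ℕ) (f : ℕ → List α) :
    (List.range N).flatMap f = (List.ofFn fun x : Fin N => f x).flatten := by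
  rw [List.flatMap_def]
  congr 1
  refine List.ext_getElem (by simp) fun i h₁ h₂ => by simp

theorem flatMap_ofFn_mul_two {α β : Type*} (N : ℕ) (f : Fin (N * 2) → α) (g : α → List β) :
    (List.ofFn f).flatMap g = (List.ofFn fun x : Fin N =>
      g (f (finProdFinEquiv (x, (0 : Fin 2)))) ++
        g (f (finProdFinEquiv (x, (1 : Fin 2))))).flatten := by
  rw [List.flatMap_def, List.map_ofFn, ofFn_mul_finProdFinEquiv, List.flatten_flatten,
    List.map_ofFn]
  congr 2
  funext x
  simp

theorem encodeRow_crossbar (one : List Bool) (G : CodedDigraph) (p : CrossbarVertex G.n)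
    (w : PlaceMark → List Γ')
    (hw : ∀ q : Fin G.n × Fin G.n, w (relativeMark p.1 q) =
      encodeEntry ((G.crossbar one).entry (crossbarIndex G.n p) (crossbarIndex G.n (q, 0))) ++
      encodeEntry ((G.crossbar one).entry (crossbarIndex G.n p) (crossbarIndex G.n (q, 1)))) :
    encodeRow (List.ofFn fun y => (G.crossbar one).entry (crossbarIndex G.n p) y) =
      (relativeMarks G.n (finProdFinEquiv p.1 : Fin (G.n * G.n))).flatMap w ++ [Γ'.comma] := by
  rw [encodeRow]
  congr 1
  rw [relativeMarks, List.flatMap_map, flatMap_range_eq]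
  refine (flatMap_ofFn_mul_two (G.n * G.n) _ encodeEntry).trans ?_
  congr 2
  funext x
  obtain ⟨q, rfl⟩ := finProdFinEquiv.surjective x
  exact (hw q).symm

theorem flatMap_placeWord (one : List Bool) (G : CodedDigraph) :
    ((List.range (G.n * G.n)).flatMap fun c =>
      placeWord one (weightAt G c) (placeMarkAt G.n c) (relativeMarks G.n c)) =
    (G.crossbar one).encode := by
  rw [flatMap_range_eq, encode, rows]
  refine Eq.trans ?_ (flatMap_ofFn_mul_two (G.n * G.n) _ encodeRow).symm
  congr 2
  funext x
  obtain ⟨p, rfl⟩ := finProdFinEquiv.surjective x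
  rw [placeMarkAt_finProdFinEquiv, weightAt_finProdFinEquiv, placeWord]
  have h₀ := encodeRow_crossbar one G (p, 0)
    (switchWord one (G.entry p.1 p.2) (placeMark G.n p.1 p.2)) fun q => by
      rw [crossbar_entry, crossbar_entry, switchWord, edgeWord]
      have hE : ¬CrossbarEdge (p, 0) (q, 0) := by simp [CrossbarEdge]
      simp only [true_and, if_neg hE, Prod.mk.injEq, and_true, one_ne_zero, and_false, if_false,
        ← switchToWire_iff, ← isHere_relativeMark]
  have h₁ := encodeRow_crossbar one G (p, 1)
    (wireWord one (placeMark G.n p.1 p.2)) fun q => by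
      rw [crossbar_entry, crossbar_entry, wireWord, edgeWord, edgeWord]
      simp only [one_ne_zero, false_and, if_false, ← wireToSwitch_iff, ← wireToWire_iff]
  refine Eq.trans ?_ (congrArg₂ (· ++ ·) h₀ h₁).symm
  simp

theorem filter_encode (G : CodedDigraph) : G.encode.filter (· ≠ Γ'.comma) =
    (List.range (G.n * G.n)).flatMap fun c => encodeEntry (weightAt G c) := by
  have hentry : ∀ a, (encodeEntry a).filter (· ≠ Γ'.comma) = encodeEntry a := by
    intro a
    rw [List.filter_eq_self]
    rcases a with - | w
    · simp [encodeEntry]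
    · simp only [encodeEntry, List.mem_cons, List.mem_append, List.mem_map, List.mem_nil_iff,
        or_false]
      rintro s (rfl | ⟨b, -, rfl⟩ | rfl) <;> simp
  rw [flatMap_range_eq, ofFn_mul_finProdFinEquiv, List.flatten_flatten, List.map_ofFn, encode, rows,
    List.flatMap_def, List.filter_flatten, List.map_map, List.map_ofFn]
  congr 2
  funext i
  simp only [Function.comp_apply, weightAt_finProdFinEquiv, encodeRow, List.filter_append,
    List.flatMap_def, List.filter_flatten, List.map_map, List.map_ofFn, Function.comp_def, hentry]
  simp

theorem count_encode (G : CodedDigraph) : G.encode.count Γ'.comma = G.n := by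
  have hentry : ∀ a, (encodeEntry a).count Γ'.comma = 0 := by
    intro a
    rw [List.count_eq_zero]
    cases a <;> simp [encodeEntry]
  have hrow : ∀ l, (encodeRow l).count Γ'.comma = 1 := by
    intro l
    have : (l.flatMap encodeEntry).count Γ'.comma = 0 := by
      rw [List.count_eq_zero, List.mem_flatMap]
      rintro ⟨a, -, h⟩
      exact List.count_eq_zero.1 (hentry a) h
    rw [encodeRow, List.count_append, this]
    simp
  rw [encode, List.count_flatMap, show List.map (List.count Γ'.comma ∘ encodeRow) G.rows =
    List.map (fun _ => 1) G.rows from List.map_congr_left fun l _ => hrow l, List.map_const',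
    List.sum_replicate]
  simp [rows]

/-! ### The running time -/

theorem length_encodeEntry_pos (a : Option (List Bool)) : 0 < (encodeEntry a).length := by
  cases a <;> simp [encodeEntry]

theorem length_edgeWord_le (one : List Bool) (b : Bool) :
    (edgeWord one b).length ≤ one.length + 2 := by
  cases b <;> simp [edgeWord, encodeEntry]

theorem length_flatMap_le {α β : Type*} (l : List α) (f : α → List β) (B : ℕ)
    (h : ∀ a ∈ l, (f a).length ≤ B) : (l.flatMap f).length ≤ l.length * B := by
  rw [List.length_flatMap, ← List.length_map (f := fun a => (f a).length), ← smul_eq_mul]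
  exact List.sum_le_card_nsmul _ _ (by simpa using h)

theorem length_placeWord_le (one : List Bool) (a : Option (List Bool)) (c : PlaceMark)
    (l : List PlaceMark) :
    (placeWord one a c l).length ≤
      l.length * ((encodeEntry a).length + 3 * one.length + 7) + 2 := by
  have h : (l.flatMap (switchWord one a c)).length ≤
      l.length * ((encodeEntry a).length + one.length + 3) := by
    refine length_flatMap_le _ _ _ fun d _ => ?_
    have h₁ := length_edgeWord_le one (switchToWire c d)
    have h₂ : (encodeEntry (if isHere d then a else none)).length ≤ (encodeEntry a).length := by
      split_ifs
      · exact le_rfl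
      · exact length_encodeEntry_pos a
    rw [switchWord, List.length_append]
    omega
  have h' : (l.flatMap (wireWord one c)).length ≤ l.length * (2 * one.length + 4) := by
    refine length_flatMap_le _ _ _ fun d _ => ?_
    have h₁ := length_edgeWord_le one (wireToSwitch c d)
    have h₂ := length_edgeWord_le one (wireToWire c d)
    rw [wireWord, List.length_append]
    omega
  rw [placeWord]
  simp only [List.length_append, List.length_cons, List.length_nil]
  have e : l.length * ((encodeEntry a).length + 3 * one.length + 7) =
      l.length * ((encodeEntry a).length + one.length + 3) +
        l.length * (2 * one.length + 4) := by ring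
  omega

section

variable (G : CodedDigraph)

theorem length_weights_le : ((List.range (G.n * G.n)).flatMap
    fun c => encodeEntry (weightAt G c)).length ≤ G.encode.length := by
  rw [← filter_encode]
  exact List.length_filter_le _ _

theorem length_weightAt_le {c : ℕ} (hc : c < G.n * G.n) :
    (encodeEntry (weightAt G c)).length ≤ G.encode.length := by
  refine le_trans ?_ (length_weights_le G)
  rw [List.length_flatMap]
  exact List.le_sum_of_mem (List.mem_map.2 ⟨c, List.mem_range.2 hc, rfl⟩)

theorem card_places_le : G.n * G.n ≤ G.encode.length := by
  refine le_trans ?_ (length_weights_le G)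
  rw [List.length_flatMap]
  have h := List.card_nsmul_le_sum
    ((List.range (G.n * G.n)).map fun c => (encodeEntry (weightAt G c)).length) 1 (by
      simp only [List.mem_map]
      rintro _ ⟨c, -, rfl⟩
      exact length_encodeEntry_pos _)
  simpa using h

theorem card_le : G.n ≤ G.encode.length := by
  conv_lhs => rw [← count_encode G]
  exact List.count_le_length

theorem length_encode_crossbar_le (one : List Bool) : (G.crossbar one).encode.length ≤
    G.encode.length * (G.encode.length * (G.encode.length + 3 * one.length + 7) + 2) := by
  have hN := card_places_le G
  rw [← flatMap_placeWord]
  refine (length_flatMap_le _ _ (G.encode.length *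
    (G.encode.length + 3 * one.length + 7) + 2) fun c hc => ?_).trans ?_
  · refine (length_placeWord_le _ _ _ _).trans ?_
    have := length_weightAt_le G (List.mem_range.1 hc)
    rw [length_relativeMarks]
    gcongr
  · rw [List.length_range]
    gcongr

end

/-- A bound on the number of steps, in terms of the length of the input. -/
noncomputable def timeBound (one : List Bool) : Polynomial ℕ :=
  .X * (.X * (.X * 2 + 10)) + 39 * .X + 30 +
    2 * (.X * (.X * (.X + Polynomial.C (3 * one.length) + 7) + 2))

theorem eval_timeBound (one : List Bool) (L : ℕ) : (timeBound one).eval L =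
    L * (L * (L * 2 + 10)) + 39 * L + 30 + 2 * (L * (L * (L + 3 * one.length + 7) + 2)) := by
  simp [timeBound]

theorem exec_crossbarProgram (one : List Bool) (G : CodedDigraph) :
    Exec (crossbarProgram one) (Registers.initial, { inp := G.encode : Memory }.stk)
      ((timeBound one).eval G.encode.length)
      (Registers.initial, { out := (G.crossbar one).encode : Memory }.stk) := by
  have h₁ := exec_countRows {} G.encode
  rw [count_encode] at h₁
  have h₂ := exec_restoreInput
    { Registers.initial with flag := ((G.n = 0 : Bool), (G.n = 1 : Bool)) }
    { cnt := ((List.range G.n).map fun i => ((i = 0 : Bool), (i = 1 : Bool), false)).reverse }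
    G.encode
  rw [filter_encode] at h₂
  set W := (List.range (G.n * G.n)).flatMap fun c => encodeEntry (weightAt G c) with hW
  have h₃ := exec_markLast
    { Registers.initial with flag := ((G.n = 0 : Bool), (G.n = 1 : Bool)) } { inp := W } G.n
  obtain ⟨⟨s, l, c, k, p, f⟩, hr, h₄⟩ := exec_buildCells
    { Registers.initial with flag := ((G.n = 0 : Bool), false) } { inp := W } G.n
  obtain rfl : s = none := hr
  rw [← map_placeMarkAt_range] at h₄
  have h₅ := exec_copyCells ⟨none, l, c, k, p, f⟩ { inp := W }
    ((List.range (G.n * G.n)).map (placeMarkAt G.n)).reverse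
  simp only [List.reverse_reverse, List.length_reverse, List.length_map, List.length_range] at h₅
  have h₆ := exec_writeRows one ⟨none, l, c, none, p, f⟩ {} (G.n * G.n) G.encode.length
    (placeMarkAt G.n) (relativeMarks G.n) (weightAt G) (fun c hc => relativeMarks_rotate hc)
    (fun c hc => length_filter_isHere hc) (length_relativeMarks G.n)
    (fun c hc => length_weightAt_le G hc)
  rw [flatMap_placeWord, relativeMarks_zero, ← hW] at h₆
  have h₇ := exec_finish ⟨none, l, c, none, none, f⟩ (relativeMarks G.n (G.n * G.n))
    (G.crossbar one).encode.reverse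
  simp only [List.reverse_reverse, List.length_reverse, length_relativeMarks] at h₇
  refine (Exec.seq h₁ <| Exec.seq h₂ <| Exec.seq h₃ <| Exec.seq h₄ <| Exec.seq h₅ <|
    Exec.seq h₆ h₇).mono ?_
  rw [eval_timeBound]
  have hn := card_le G
  have hN := card_places_le G
  have hout := length_encode_crossbar_le G one
  have h : G.n * G.n * (G.n * G.n * (G.encode.length * 2 + 10) + 14) ≤
      G.encode.length * (G.encode.length * (G.encode.length * 2 + 10) + 14) := by gcongr
  rw [Nat.mul_add G.encode.length _ 14] at h
  have h' : G.n * (G.n * 4 + 9) = G.n * G.n * 4 + G.n * 9 := by ring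
  omega

/-- The crossbar is computable in polynomial time. -/
theorem isPolyTime_crossbar (one : List Bool) : IsPolyTime (crossbar one) := by
  refine computableInPolyTime (crossbarProgram one) Registers.initial .inp .out
    (Equiv.refl Γ') (Equiv.refl Γ') (timeBound one) fun G => ?_
  have h₀ : ∀ l : List Γ', Function.update (fun _ => [] : ∀ k, List (Symb k)) Stack.inp l =
      ({ inp := l } : Memory).stk := fun l => by funext k; cases k <;> rfl
  have h₁ : ∀ l : List Γ', Function.update (fun _ => [] : ∀ k, List (Symb k)) Stack.out l =
      ({ out := l } : Memory).stk := fun l => by funext k; cases k <;> rfl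
  have h := exec_crossbarProgram one G
  rw [← h₀, ← h₁] at h
  simpa using h

end CrossbarMachine

theorem theorem6 (one : List Bool) :
    (∃ r : CodedDigraph → CodedDigraph, IsPolyTime r ∧
      ∀ (R : Type*) [Ring R] (c : List Bool → Option R), c one = some 1 →
        IsManyOneReduction r (CPerm c) (planarCPerm c)) ∧
    (∃ r : CodedDigraph → CodedDigraph, IsPolyTime r ∧
      ∀ (R : Type*) [Ring R] (c : List Bool → Option R), c one = some 1 →
        IsManyOneReduction r (CDet c) (planarCDet c)) :=
  ⟨⟨CodedDigraph.crossbar one, CrossbarMachine.isPolyTime_crossbar one,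
      fun _ _ _ h => CodedDigraph.isManyOneReduction_crossbar_perm h⟩,
    ⟨CodedDigraph.crossbar one, CrossbarMachine.isPolyTime_crossbar one,
      fun _ _ _ h => CodedDigraph.isManyOneReduction_crossbar_det h⟩⟩
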